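/- Work in $\mathbb R^3$; "polytope" means full-dimensional convex polytope unless said otherwise, and indices of $A_i,B_i$ are cyclic modulo $3$ (so $A_4=A_1$, etc.). Six distinct points $A_1,A_2,A_3,B_1,B_2,B_3$ are in *Schönhardt position* if they are the vertices of a (non-convex) polytope whose facets are the eight triangles $A_1A_2A_3$, $B_1B_2B_3$, $A_iB_iA_{i+1}$ and $B_iA_{i+1}B_{i+1}$ ($i=1,2,3$; facets sharing an edge are not coplanar) and whose interior angle exceeds $\pi$ at exactly the three edges $B_iA_{i+1}$. Their *visibility cone* is the closed triangular cone bounded by the planes $B_iB_{i+1}A_{i+1}$ ($i=1,2,3$) that contains the triangle $B_1B_2B_3$, i.e. the set of points that for every $i$ lie weakly on the same side of the plane $B_iB_{i+1}A_{i+1}$ as $B_{i+2}$. A polytope $C$ is a *cupola* of chain length $m\ge 0$ if 1. its vertices are the $3(m+2)$ distinct points $q^{i}_k$ ($i=1,2,3$, $0\le k\le m+1$), where $q^{i}_0=A_i$ and $q^{i}_{m+1}=B_{i+1}$; 2. $A_1,A_2,A_3,B_1,B_2,B_3$ are in Schönhardt position, and $A_1A_2A_3$ (the bottom facet) and $B_1B_2B_3$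 (the skylight) are facets of $C$; 3. the other facets of $C$ are exactly the triangles $B_i\,q^{i}_k\,q^{i}_{k+1}$ and $A_{i+1}\,q^{i}_k\,q^{i}_{k+1}$ for $i=1,2,3$ and $0\le k\le m$; 4. for $i=1,2,3$ and $1\le k\le m$, the vertex $q^{i}_k$ lies strictly on the side of the plane $B_iA_{i+1}B_{i+2}$ opposite to $B_{i+1}$. A *triangulation* of a polytope $P$ is a finite set of non-degenerate tetrahedra whose union is $P$, whose vertices are vertices of $P$, and any two of which intersect in a common (possibly empty) face. **Proposition.** Let $C$ be a cupola of chain length $m$ that is part of a larger polytope $P$: $C\subseteq P$, the closure $Q$ of $P\setminus C$ is a polytope, and the bottom facet $A_1A_2A_3$ of $C$ is also a facet of $Q$. Let $n$ be the number of vertices of $P$. If $T$ is a triangulation of $P$ such that the fourth vertex of the tetrahedron of $T$ containing the skylight $B_1B_2B_3$ is not in the visibility cone of $C$, then $T$ has at least $n+m-3$ tetrahedra. -/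

import Mathlib

/-- Euclidean three-space. -/
abbrev Space3 : Type := EuclideanSpace ℝ (Fin 3)

/-- A (full-dimensional) convex 3-polytope: the convex hull of finitely many points, with nonempty
interior. -/
def IsConvexPolytope (P : Set Space3) : Prop :=
  (∃ s : Set Space3, s.Finite ∧ P = convexHull ℝ s) ∧ (interior P).Nonempty

/-- `F` is a facet of the convex 3-polytope `P`: a two-dimensional face, where a face is the set of
points of `P` at which some linear functional attains its maximum over `P`. -/
def IsFacet (P F : Set Space3) : Prop :=
  IsExposed ℝ P F ∧ Module.finrank ℝ (vectorSpan ℝ F) = 2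

/-- `T` (a finite set of tetrahedra, each given by its set of vertices) is a triangulation of the
convex polytope `P`: the tetrahedra are non-degenerate, their vertices are extreme points of `P`,
any two of them meet in a common (possibly empty) face, and their union is `P`. -/
structure IsTriangulation (P : Set Space3) (T : Finset (Finset Space3)) : Prop where
  card_eq : ∀ t ∈ T, t.card = 4
  indep : ∀ t ∈ T, AffineIndependent ℝ ((↑) : t → Space3)
  vertices : ∀ t ∈ T, (t : Set Space3) ⊆ Set.extremePoints ℝ P
  inter : ∀ s ∈ T, ∀ t ∈ T,
    convexHull ℝ (s : Set Space3) ∩ convexHull ℝ (t : Set Space3) =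
      convexHull ℝ ((s : Set Space3) ∩ (t : Set Space3))
  cover : ⋃ t ∈ T, convexHull ℝ (t : Set Space3) = P

/-- `S` is convex near the point `x`. For `x` in the relative interior of an edge of a
three-dimensional polyhedral solid `S`, this says that the interior angle of `S` at that edge is
at most `π`. -/
def LocallyConvexAt (S : Set Space3) (x : Space3) : Prop :=
  ∃ ε : ℝ, 0 < ε ∧ Convex ℝ (S ∩ Metric.ball x ε)

/-- The vertex sets of the eight triangular facets of a Schönhardt polytope with bottom
`A 0, A 1, A 2` and top `B 0, B 1, B 2`. Indices are cyclic (in `Fin 3`). -/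
def schonhardtTriangles (A B : Fin 3 → Space3) : Set (Set Space3) :=
  {Set.range A, Set.range B} ∪
    ((Set.range fun i : Fin 3 => {A i, B i, A (i + 1)}) ∪
      (Set.range fun i : Fin 3 => {B i, A (i + 1), B (i + 1)}))

/-- `S` is a Schönhardt polytope with vertices `A i`, `B i`: a (non-convex) polytope whose facets
are the eight triangles above and whose reflex edges (interior angle greater than `π`) are exactly
the diagonals `B i, A (i + 1)`. -/
structure IsSchonhardtPolytope (A B : Fin 3 → Space3) (S : Set Space3) : Prop where
  /-- the six vertices are distinct -/
  vertices_injective : Function.Injective (Sum.elim A B)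
  /-- the facets are non-degenerate triangles -/
  indep : ∀ s ∈ schonhardtTriangles A B, AffineIndependent ℝ ((↑) : s → Space3)
  /-- two facets meet only in a common vertex or edge, or not at all -/
  inter : ∀ s ∈ schonhardtTriangles A B, ∀ t ∈ schonhardtTriangles A B,
    convexHull ℝ s ∩ convexHull ℝ t = convexHull ℝ (s ∩ t)
  /-- facets which share an edge lie in different planes, i.e. no interior angle equals `π` -/
  not_coplanar : ∀ s ∈ schonhardtTriangles A B, ∀ t ∈ schonhardtTriangles A B,
    s ≠ t → (s ∩ t).ncard = 2 → ¬ Coplanar ℝ (s ∪ t)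
  /-- `S` is a compact solid bounded by the eight facets -/
  isCompact : IsCompact S
  closure_interior : closure (interior S) = S
  frontier_eq : frontier S = ⋃ s ∈ schonhardtTriangles A B, convexHull ℝ s
  /-- the three diagonals are reflex -/
  reflex : ∀ i, ∀ x ∈ openSegment ℝ (B i) (A (i + 1)), ¬ LocallyConvexAt S x
  /-- the nine other edges are not reflex -/
  convex_bottom : ∀ i, ∀ x ∈ openSegment ℝ (A i) (A (i + 1)), LocallyConvexAt S x
  convex_top : ∀ i, ∀ x ∈ openSegment ℝ (B i) (B (i + 1)), LocallyConvexAt S x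
  convex_side : ∀ i, ∀ x ∈ openSegment ℝ (A i) (B i), LocallyConvexAt S x

/-- Six points are in Schönhardt position if they are the vertices of a Schönhardt polytope. -/
def SchonhardtPosition (A B : Fin 3 → Space3) : Prop :=
  ∃ S : Set Space3, IsSchonhardtPolytope A B S

/-- The visibility cone: the triangular cone bounded by the planes `B i, B (i + 1), A (i + 1)`
and containing the skylight `B 0, B 1, B 2`, i.e. the set of points which, for every `i`, lie on
the same (closed) side of the plane `B i, B (i + 1), A (i + 1)` as `B (i + 2)`. -/
def visibilityCone (A B : Fin 3 → Space3) : Set Space3 :=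
  {x | ∀ i : Fin 3,
    (affineSpan ℝ {B i, B (i + 1), A (i + 1)}).WSameSide (B (i + 2)) x}

/-- `C` is a cupola of chain length `m` with bottom facet `A 0, A 1, A 2`, skylight
`B 0, B 1, B 2`, and vertex-edge chains `q i 0 = A i, q i 1, …, q i m, q i (m+1) = B (i + 1)`. -/
structure IsCupola (m : ℕ) (A B : Fin 3 → Space3) (q : Fin 3 → Fin (m + 2) → Space3)
    (C : Set Space3) : Prop where
  isConvexPolytope : IsConvexPolytope C
  chain_zero : ∀ i, q i 0 = A i
  chain_last : ∀ i, q i (Fin.last (m + 1)) = B (i + 1)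
  /-- the `3 * (m + 2)` points `q i k` (including all `A i` and `B i`) are distinct and are
  exactly the vertices of `C` -/
  chain_injective : Function.Injective fun p : Fin 3 × Fin (m + 2) => q p.1 p.2
  vertices : Set.extremePoints ℝ C = Set.range fun p : Fin 3 × Fin (m + 2) => q p.1 p.2
  schonhardt : SchonhardtPosition A B
  /-- the facets of `C` are the bottom, the skylight, and the triangles joining the edges of the
  `i`-th chain to `B i` and to `A (i + 1)` -/
  facets : {F | IsFacet C F} =
    {convexHull ℝ (Set.range A), convexHull ℝ (Set.range B)} ∪
      ((Set.range fun p : Fin 3 × Fin (m + 1) =>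
          convexHull ℝ {B p.1, q p.1 p.2.castSucc, q p.1 p.2.succ}) ∪
        (Set.range fun p : Fin 3 × Fin (m + 1) =>
          convexHull ℝ {A (p.1 + 1), q p.1 p.2.castSucc, q p.1 p.2.succ}))
  /-- the inner vertices of the `i`-th chain lie strictly on the side of the plane
  `B i, A (i + 1), B (i + 2)` opposite to `B (i + 1)` -/
  opposite : ∀ i, ∀ k : Fin (m + 2), k ≠ 0 → k ≠ Fin.last (m + 1) →
    (affineSpan ℝ {B i, A (i + 1), B (i + 2)}).SOppSide (B (i + 1)) (q i k)

/-! A triangulation of `P` that uses only vertices of `P` has exactly `n + e - 3` tetrahedra, where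
`e` is the number of its edges that meet the interior of `P` (`card_add_three`). So it suffices to
find `m` interior edges; for `m = 0` the count alone is enough.

The count is an Euler characteristic computation. The alternating number of faces meeting the
interior of `P` is 1, and it is again 1 when only the faces through a fixed vertex are counted. Both
statements come from one indicator identity for the triangulation (`indicator_identity`), to which
`eulerRelation` is applied in space and `EulerRelation.slice` in a plane cutting off one vertex.
Eliminating the triangles gives the formula.

Suppose the fourth vertex `x` at the skylight is separated from `B (i + 2)` by the plane of `B i`,
`B (i + 1)`, `A (i + 1)`. The facets at `B (i + 1)`, together with the position of the last inner
chain vertex beyond the plane of `B i`, `A (i + 1)`, `B (i + 2)`, force `x` beyond that plane as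
well. Hence the triangle `x`, `B (i + 1)`, `B (i + 2)` meets the line through `B i` and `A (i + 1)`,
and this diagonal is not an edge of the triangulation (`not_diagonal`).

The segment from `B i` to an inner chain vertex `q i k` is an edge of `P`, so it is present in the
triangulation. Seen from `B i` the chain is in convex position. A tetrahedron at this edge, chosen
to contain points pushed towards the middle of the chord of the chain, has either chain vertices
with indices `a < k < b`, or a vertex `y` off the chain (`exists_tetrahedron`). In the first case
the edge from `q i a` to `q i b` is interior. In the second case `y ≠ A (i + 1)`, and the edge from
`q i k` to `y` is interior unless `k = 1` and `y` lies outside `C`; then the edge from `B i` to `y`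
is interior and is used instead. The chosen edge determines `k`, which yields `m` interior edges
(`le_card_interior_edges`). -/

open Filter Topology

/-! ### Euler characteristics from indicator identities -/

/-- The one-dimensional Euler characteristic relation, read off from the jumps to the right. -/
theorem sum_eq_neg_of_indicator_Icc_eq {ι : Type*} (S : Finset ι) (c : ι → ℤ) (a b : ι → ℝ)
    (hab : ∀ i ∈ S, a i ≤ b i) (e : ℤ) (α β : ℝ) (hαβ : α < β)
    (h : ∀ s : ℝ, ∑ i ∈ S, (if a i ≤ s ∧ s ≤ b i then c i else 0) =
      if α < s ∧ s < β then e else 0) :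
    ∑ i ∈ S, c i = -e := by
  classical
  -- The value at `s` minus the limit from the right is the total weight of the intervals ending at
  -- `s`. For the open interval this difference is `-e` at `α` and zero elsewhere, including at `β`,
  -- where both values vanish.
  have key : ∀ s : ℝ, ∑ i ∈ S.filter (fun i => b i = s), c i = if s = α then -e else 0 := by
    intro s
    have ev1 : ∀ᶠ x in 𝓝[>] s, ∀ i ∈ S, ((a i ≤ x ∧ x ≤ b i) ↔ (a i ≤ s ∧ s < b i)) := by
      rw [Finset.eventually_all]
      intro i _
      have e1 : ∀ᶠ x in 𝓝[>] s, (a i ≤ x ↔ a i ≤ s) := by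
        rcases le_or_gt (a i) s with h1 | h1
        · filter_upwards [self_mem_nhdsWithin] with x hx
          have : s < x := hx
          constructor <;> intro <;> linarith
        · filter_upwards [mem_nhdsWithin_of_mem_nhds (Iio_mem_nhds h1)] with x hx
          have : x < a i := hx
          constructor <;> intro <;> linarith
      have e2 : ∀ᶠ x in 𝓝[>] s, (x ≤ b i ↔ s < b i) := by
        rcases lt_or_ge s (b i) with h1 | h1
        · filter_upwards [mem_nhdsWithin_of_mem_nhds (Iio_mem_nhds h1)] with x hx
          have : x < b i := hx
          constructor <;> intro <;> linarith
        · filter_upwards [self_mem_nhdsWithin] with x hx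
          have : s < x := hx
          constructor <;> intro <;> linarith
      filter_upwards [e1, e2] with x h1 h2
      rw [h1, h2]
    have ev2 : ∀ᶠ x in 𝓝[>] s, ((α < x ∧ x < β) ↔ (α ≤ s ∧ s < β)) := by
      have e1 : ∀ᶠ x in 𝓝[>] s, (α < x ↔ α ≤ s) := by
        rcases le_or_gt α s with h1 | h1
        · filter_upwards [self_mem_nhdsWithin] with x hx
          have : s < x := hx
          constructor <;> intro <;> linarith
        · filter_upwards [mem_nhdsWithin_of_mem_nhds (Iio_mem_nhds h1)] with x hx
          have : x < α := hx
          constructor <;> intro <;> linarith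
      have e2 : ∀ᶠ x in 𝓝[>] s, (x < β ↔ s < β) := by
        rcases lt_or_ge s β with h1 | h1
        · filter_upwards [mem_nhdsWithin_of_mem_nhds (Iio_mem_nhds h1)] with x hx
          have : x < β := hx
          constructor <;> intro <;> linarith
        · filter_upwards [self_mem_nhdsWithin] with x hx
          have : s < x := hx
          constructor <;> intro <;> linarith
      filter_upwards [e1, e2] with x h1 h2
      rw [h1, h2]
    obtain ⟨x, hx1, hx2⟩ := (ev1.and ev2).exists
    have hs := h s
    have hx := h x
    rw [Finset.sum_congr rfl (fun i hi => if_congr (hx1 i hi) rfl rfl), if_congr hx2 rfl rfl] at hx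
    have : ∑ i ∈ S.filter (fun i => b i = s), c i =
        ∑ i ∈ S, (if a i ≤ s ∧ s ≤ b i then c i else 0) -
        ∑ i ∈ S, (if a i ≤ s ∧ s < b i then c i else 0) := by
      rw [Finset.sum_filter, ← Finset.sum_sub_distrib]
      refine Finset.sum_congr rfl fun i hi => ?_
      have := hab i hi
      split_ifs <;> first | rfl | (exfalso; grind) | simp
    rw [this, hs, hx]
    split_ifs <;> first | rfl | (exfalso; grind) | simp
  have : ∑ i ∈ S, c i = ∑ s ∈ insert α (S.image b), ∑ i ∈ S.filter (fun i => b i = s), c i := by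
    rw [Finset.sum_fiberwise_of_maps_to]
    intro i hi
    exact Finset.mem_insert_of_mem (Finset.mem_image_of_mem _ hi)
  rw [this, Finset.sum_congr rfl (fun s _ => key s)]
  simp

-- Compact convex subsets of the line are closed intervals and bounded open convex ones are open
-- intervals, so this is the interval relation with empty sets allowed.
open Classical in
theorem sum_eq_of_indicator_image {ι : Type*} (S : Finset ι) (c : ι → ℤ) (J : ι → Set ℝ)
    (hJ : ∀ i ∈ S, IsCompact (J i)) (hJc : ∀ i ∈ S, Convex ℝ (J i)) (V : Set ℝ)
    (hV : IsOpen V) (hVc : Convex ℝ V) (hVb : Bornology.IsBounded V) (e : ℤ)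
    (h : ∀ s : ℝ, ∑ i ∈ S, (if s ∈ J i then c i else 0) = if s ∈ V then e else 0) :
    ∑ i ∈ S, (if (J i).Nonempty then c i else 0) = if V.Nonempty then -e else 0 := by
  -- If `V` is empty, the endpoints are arbitrary: the weight passed on below is then 0.
  have hVI : ∃ α β : ℝ, α < β ∧ ∀ s, (s ∈ V ∧ V.Nonempty) ↔ (α < s ∧ s < β) ∧ V.Nonempty := by
    by_cases hne : V.Nonempty
    · have hlt : ∀ s ∈ V, sInf V < s ∧ s < sSup V := by
        intro s hs
        obtain ⟨y, hy, hyV⟩ := ((frequently_lt_nhds s).and_eventually (hV.mem_nhds hs)).exists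
        obtain ⟨z, hz, hzV⟩ := ((frequently_gt_nhds s).and_eventually (hV.mem_nhds hs)).exists
        exact ⟨(csInf_le hVb.bddBelow hyV).trans_lt hy, hz.trans_le (le_csSup hVb.bddAbove hzV)⟩
      obtain ⟨s0, hs0⟩ := hne
      refine ⟨sInf V, sSup V, (hlt s0 hs0).1.trans (hlt s0 hs0).2, fun s => ?_⟩
      constructor
      · exact fun ⟨h1, h2⟩ => ⟨hlt s h1, h2⟩
      · exact fun ⟨h1, h2⟩ =>
          ⟨IsConnected.Ioo_csInf_csSup_subset ⟨⟨s0, hs0⟩, hVc.isPreconnected⟩ hVb.bddBelow hVb.bddAbove h1, h2⟩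
    · exact ⟨0, 1, one_pos, by simp [hne]⟩
  have hJI : ∀ i ∈ S, (J i).Nonempty → J i = Set.Icc (sInf (J i)) (sSup (J i)) := by
    intro i hi hne
    exact eq_Icc_of_connected_compact ⟨hne, (hJc i hi).isPreconnected⟩ (hJ i hi)
  obtain ⟨α, β, hαβ, hV2⟩ := hVI
  rw [← Finset.sum_filter]
  have := sum_eq_neg_of_indicator_Icc_eq (S.filter fun i => (J i).Nonempty) c
    (fun i => sInf (J i)) (fun i => sSup (J i)) ?_ (if V.Nonempty then e else 0) α β hαβ ?_
  · rw [this]; split_ifs <;> simp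
  · intro i hi
    rw [Finset.mem_filter] at hi
    exact Real.sInf_le_sSup _ (hJ i hi.1).bddBelow (hJ i hi.1).bddAbove
  · intro s
    have hs := h s
    rw [Finset.sum_filter]
    trans ∑ i ∈ S, (if s ∈ J i then c i else 0)
    · refine Finset.sum_congr rfl fun i hi => ?_
      by_cases hne : (J i).Nonempty
      · have : s ∈ J i ↔ sInf (J i) ≤ s ∧ s ≤ sSup (J i) := by
          conv_lhs => rw [hJI i hi hne]
          rfl
        simp only [this, hne, if_true]
      · have : s ∉ J i := fun h => hne ⟨s, h⟩
        simp [hne, this]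
    · rw [hs]
      have := hV2 s
      by_cases hne : V.Nonempty
      · simp only [hne, and_true] at this
        simp [hne, this]
      · have : s ∉ V := fun h => hne ⟨s, h⟩
        simp [hne, this]

open Classical in
/-- In dimension `d`, an indicator identity between compact convex sets and one bounded open convex
set forces the corresponding identity of Euler characteristics. -/
def EulerRelation (d : ℕ) : Prop :=
  ∀ {E : Type} [NormedAddCommGroup E] [NormedSpace ℝ E]
    [FiniteDimensional ℝ E], Module.finrank ℝ E = d → ∀ {ι : Type} (S : Finset ι) (c : ι → ℤ)
    (K : ι → Set E), (∀ i ∈ S, IsCompact (K i)) → (∀ i ∈ S, Convex ℝ (K i)) → ∀ U : Set E,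
    IsOpen U → Convex ℝ U → Bornology.IsBounded U → ∀ e : ℤ,
    (∀ x : E, ∑ i ∈ S, (if x ∈ K i then c i else 0) = if x ∈ U then e else 0) →
    ∑ i ∈ S, (if (K i).Nonempty then c i else 0) = if U.Nonempty then (-1) ^ d * e else 0

-- Restricting the identity to the hyperplane `l = s`, translated to the kernel of `l`, gives the
-- relation one dimension lower. A convex set meets the hyperplane exactly when `s` is in its image,
-- so the result is an indicator identity on the line. It drives the induction, and it also yields
-- the count at a single vertex.
open Classical in
theorem EulerRelation.slice {d : ℕ} (ih : EulerRelation d) {E : Type} [NormedAddCommGroup E]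
    [NormedSpace ℝ E] [FiniteDimensional ℝ E] (hE : Module.finrank ℝ E = d + 1) {ι : Type}
    (S : Finset ι) (c : ι → ℤ) (K : ι → Set E) (hKc : ∀ i ∈ S, IsCompact (K i))
    (hK : ∀ i ∈ S, Convex ℝ (K i)) (U : Set E) (hU : IsOpen U) (hUc : Convex ℝ U)
    (hUb : Bornology.IsBounded U) (e : ℤ)
    (h : ∀ x : E, ∑ i ∈ S, (if x ∈ K i then c i else 0) = if x ∈ U then e else 0)
    (l : E →L[ℝ] ℝ) (hl0 : l ≠ 0) (s : ℝ) :
    ∑ i ∈ S, (if s ∈ l '' K i then c i else 0) = if s ∈ l '' U then (-1) ^ d * e else 0 := by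
  obtain ⟨v, hlv⟩ : ∃ v, l v ≠ 0 := by
    by_contra! h0
    exact hl0 (ContinuousLinearMap.ext h0)
  have hl : (l : E →ₗ[ℝ] ℝ) ≠ 0 := fun h0 => hlv (by simpa using LinearMap.congr_fun h0 v)
  have hker : Module.finrank ℝ (LinearMap.ker (l : E →ₗ[ℝ] ℝ)) = d := by
    have := Module.Dual.finrank_ker_add_one_of_ne_zero hl
    omega
  let p : E := (s / l v) • v
  have hp : l p = s := by simp [p, hlv]
  let f : LinearMap.ker (l : E →ₗ[ℝ] ℝ) → E := fun y => y + p
  have hf : Topology.IsClosedEmbedding f :=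
    (Homeomorph.addRight p).isClosedEmbedding.comp
      (Submodule.closed_of_finiteDimensional _).isClosedEmbedding_subtypeVal
  have hfc : ∀ X : Set E, Convex ℝ X → Convex ℝ (f ⁻¹' X) := by
    intro X hX x hx y hy a b ha hb hab
    have := hX hx hy ha hb hab
    have h2 : f (a • x + b • y) = a • f x + b • f y := by
      simp only [f, Submodule.coe_add, Submodule.coe_smul]
      have : p = (a + b) • p := by rw [hab, one_smul]
      nth_rewrite 1 [this]
      module
    show f _ ∈ X
    rw [h2]; exact this
  have hne : ∀ X : Set E, (f ⁻¹' X).Nonempty ↔ s ∈ l '' X := by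
    intro X
    constructor
    · rintro ⟨y, hy⟩
      refine ⟨f y, hy, ?_⟩
      have : l y = 0 := y.2
      simp [f, this, hp]
    · rintro ⟨x, hx, hxs⟩
      refine ⟨⟨x - p, ?_⟩, ?_⟩
      · simp [hp, hxs]
      · simpa [f] using hx
  have := ih hker S c (fun i => f ⁻¹' K i) (fun i hi => hf.isCompact_preimage (hKc i hi))
    (fun i hi => hfc _ (hK i hi)) (f ⁻¹' U) (hU.preimage hf.continuous) (hfc _ hUc) ?_ e
    (fun y => h (f y))
  · simpa only [hne] using this
  · obtain ⟨R, hR⟩ := hUb.exists_norm_le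
    refine (isBounded_iff_forall_norm_le.2 ⟨R + ‖p‖, fun y hy => ?_⟩)
    have h1 : ‖(y : E) + p‖ ≤ R := hR _ hy
    have h2 : ‖(y : E)‖ ≤ ‖(y : E) + p‖ + ‖p‖ := by
      simpa using norm_sub_le ((y : E) + p) p
    show ‖(y : E)‖ ≤ _
    linarith

-- Induction on the dimension by projecting along a nonzero functional: the slices give an identity
-- between intervals, and each passage through the line contributes a factor `-1`.
open Classical in
theorem eulerRelation (d : ℕ) : EulerRelation d := by
  induction d with
  | zero =>
    intro E _ _ _ hE ι S c K _ _ U _ _ _ e h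
    have : Subsingleton E := Module.finrank_zero_iff.1 hE
    have hK : ∀ X : Set E, X.Nonempty ↔ (0 : E) ∈ X := fun X =>
      ⟨fun ⟨x, hx⟩ => by rwa [Subsingleton.elim 0 x], fun hx => ⟨0, hx⟩⟩
    simp only [hK, pow_zero, one_mul]
    exact h 0
  | succ d ih =>
    intro E _ _ _ hE ι S c K hKc hK U hU hUc hUb e h
    have : Nontrivial E := Module.nontrivial_of_finrank_pos (R := ℝ) (by omega)
    obtain ⟨v, hv⟩ := exists_ne (0 : E)
    obtain ⟨l, -, hlv⟩ := exists_dual_vector ℝ v (norm_ne_zero_iff.2 hv)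
    have hlv : l v ≠ 0 := by
      rw [hlv]; simpa using hv
    have hl : l ≠ 0 := fun h0 => hlv (by simp [h0])
    have hlin : IsLinearMap ℝ l := (l : E →ₗ[ℝ] ℝ).isLinear
    have hlo : IsOpenMap l := l.isOpenMap_of_ne_zero hl
    have := sum_eq_of_indicator_image S c (fun i => l '' K i)
      (fun i hi => (hKc i hi).image l.continuous) (fun i hi => (hK i hi).is_linear_image hlin)
      (l '' U) (hlo _ hU) (hUc.is_linear_image hlin) (l.lipschitz.isBounded_image hUb) _
      (ih.slice hE S c K hKc hK U hU hUc hUb e h l hl)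
    simp only [Set.image_nonempty] at this
    rw [this]
    split_ifs <;> ring

/-! ### Faces of a triangulation and carriers -/

open Classical in
/-- The nonempty faces of the tetrahedra in `T`. -/
noncomputable def triangulationFaces (T : Finset (Finset Space3)) : Finset (Finset Space3) :=
  (T.biUnion Finset.powerset).erase ∅

theorem mem_triangulationFaces {T : Finset (Finset Space3)} {F : Finset Space3} :
    F ∈ triangulationFaces T ↔ F.Nonempty ∧ ∃ t ∈ T, F ⊆ t := by
  simp [triangulationFaces, Finset.nonempty_iff_ne_empty]

/-- A face is interior if its convex hull meets the interior of `P`. -/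
def IsInteriorFace (P : Set Space3) (F : Finset Space3) : Prop :=
  (convexHull ℝ (F : Set Space3) ∩ interior P).Nonempty

open Classical in
noncomputable def interiorFaces (P : Set Space3) (T : Finset (Finset Space3)) :
    Finset (Finset Space3) :=
  (triangulationFaces T).filter (IsInteriorFace P)

theorem IsConvexPolytope.convex {P : Set Space3} (hP : IsConvexPolytope P) : Convex ℝ P := by
  obtain ⟨⟨s, hs, rfl⟩, -⟩ := hP
  exact convex_convexHull ℝ s

theorem IsConvexPolytope.isCompact {P : Set Space3} (hP : IsConvexPolytope P) : IsCompact P := by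
  obtain ⟨⟨s, hs, rfl⟩, -⟩ := hP
  exact hs.isCompact_convexHull ℝ

theorem IsConvexPolytope.finite_extremePoints {P : Set Space3} (hP : IsConvexPolytope P) :
    (Set.extremePoints ℝ P).Finite := by
  obtain ⟨⟨s, hs, rfl⟩, -⟩ := hP
  exact hs.subset extremePoints_convexHull_subset

theorem IsConvexPolytope.convexHull_extremePoints {P : Set Space3} (hP : IsConvexPolytope P) :
    convexHull ℝ (Set.extremePoints ℝ P) = P := by
  conv_rhs => rw [← closure_convexHull_extremePoints hP.isCompact hP.convex]
  exact ((hP.finite_extremePoints.isCompact_convexHull ℝ).isClosed.closure_eq).symm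

theorem mem_of_mem_extremePoints_of_mem_convexHull {E : Type*} [AddCommGroup E] [Module ℝ E]
    {P s : Set E} {x : E} (hx : x ∈ Set.extremePoints ℝ P) (hs : convexHull ℝ s ⊆ P)
    (hxs : x ∈ convexHull ℝ s) : x ∈ s := by
  have : x ∈ Set.extremePoints ℝ (convexHull ℝ s) :=
    inter_extremePoints_subset_extremePoints_of_subset hs ⟨hxs, hx⟩
  exact extremePoints_convexHull_subset this

namespace IsTriangulation

variable {P : Set Space3} {T : Finset (Finset Space3)}

theorem convexHull_subset (hT : IsTriangulation P T) {F : Finset Space3}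
    (hF : F ∈ triangulationFaces T) : convexHull ℝ (F : Set Space3) ⊆ P := by
  obtain ⟨-, t, ht, hFt⟩ := mem_triangulationFaces.1 hF
  rw [← hT.cover]
  exact (convexHull_mono (by exact_mod_cast hFt)).trans
    (Set.subset_biUnion_of_mem (u := fun t : Finset Space3 => convexHull ℝ (t : Set Space3)) ht)

-- The intersection property passes from tetrahedra to their faces, because within one tetrahedron
-- affine independence makes convex hulls commute with intersections of vertex sets.
open Classical in
theorem faces_inter (hT : IsTriangulation P T) {F G : Finset Space3}
    (hF : F ∈ triangulationFaces T) (hG : G ∈ triangulationFaces T) :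
    convexHull ℝ (F : Set Space3) ∩ convexHull ℝ (G : Set Space3) ⊆
      convexHull ℝ ((F ∩ G : Finset Space3) : Set Space3) := by
  obtain ⟨-, s, hs, hFs⟩ := mem_triangulationFaces.1 hF
  obtain ⟨-, t, ht, hGt⟩ := mem_triangulationFaces.1 hG
  rintro x ⟨hxF, hxG⟩
  have h1 : x ∈ convexHull ℝ ((s ∩ t : Finset Space3) : Set Space3) := by
    rw [Finset.coe_inter, ← hT.inter s hs t ht]
    exact ⟨convexHull_mono (by exact_mod_cast hFs) hxF, convexHull_mono (by exact_mod_cast hGt) hxG⟩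
  have h2 : x ∈ convexHull ℝ ((F ∩ (s ∩ t) : Finset Space3) : Set Space3) := by
    rw [Finset.coe_inter, (hT.indep s hs).convexHull_inter hFs Finset.inter_subset_left]
    exact ⟨hxF, h1⟩
  have h3 : x ∈ convexHull ℝ (((F ∩ (s ∩ t)) ∩ G : Finset Space3) : Set Space3) := by
    rw [Finset.coe_inter, (hT.indep t ht).convexHull_inter
      (Finset.inter_subset_right.trans Finset.inter_subset_right) hGt]
    exact ⟨h2, hxG⟩
  refine convexHull_mono ?_ h3
  intro y hy
  simp only [Finset.coe_inter, Set.mem_inter_iff] at hy ⊢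
  exact ⟨hy.1.1, hy.2⟩

/-- Every point of `P` has a carrier: a face contained in all faces that contain the point. -/
theorem exists_carrier (hT : IsTriangulation P T) {x : Space3} (hx : x ∈ P) :
    ∃ σ ∈ triangulationFaces T, x ∈ convexHull ℝ (σ : Set Space3) ∧
      ∀ τ ∈ triangulationFaces T, x ∈ convexHull ℝ (τ : Set Space3) → σ ⊆ τ := by
  classical
  have hne : ((triangulationFaces T).filter
      fun σ : Finset Space3 => x ∈ convexHull ℝ (σ : Set Space3)).Nonempty := by
    rw [← hT.cover] at hx
    simp only [Set.mem_iUnion] at hx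
    obtain ⟨t, ht, hxt⟩ := hx
    refine ⟨t, Finset.mem_filter.2 ⟨mem_triangulationFaces.2 ⟨?_, t, ht, subset_rfl⟩, hxt⟩⟩
    exact Finset.coe_nonempty.1 (convexHull_nonempty_iff.1 ⟨x, hxt⟩)
  -- A face of least cardinality containing `x` works: its intersection with any other such face
  -- again contains `x`.
  obtain ⟨σ, hσ, hmin⟩ := Finset.exists_min_image _ Finset.card hne
  rw [Finset.mem_filter] at hσ
  refine ⟨σ, hσ.1, hσ.2, fun τ hτ hxτ => ?_⟩
  have hx' := hT.faces_inter hσ.1 hτ ⟨hσ.2, hxτ⟩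
  have hmem : σ ∩ τ ∈ triangulationFaces T := by
    obtain ⟨-, t, ht, hst⟩ := mem_triangulationFaces.1 hσ.1
    exact mem_triangulationFaces.2 ⟨Finset.coe_nonempty.1 (convexHull_nonempty_iff.1 ⟨x, hx'⟩), t,
      ht, Finset.inter_subset_left.trans hst⟩
  have := hmin _ (Finset.mem_filter.2 ⟨hmem, hx'⟩)
  have := Finset.eq_of_subset_of_card_le Finset.inter_subset_left this
  rw [← this]
  exact Finset.inter_subset_right

end IsTriangulation

/-- A point all of whose barycentric coordinates are positive is interior as soon as some point of
the simplex is. -/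
theorem mem_interior_of_carrier {P : Set Space3} (hP : Convex ℝ P) {σ : Finset Space3}
    (hσP : convexHull ℝ (σ : Set Space3) ⊆ P) {x : Space3}
    (hx : x ∈ convexHull ℝ (σ : Set Space3))
    (hmin : ∀ τ ⊂ σ, x ∉ convexHull ℝ (τ : Set Space3)) (hσ : IsInteriorFace P σ) :
    x ∈ interior P := by
  classical
  obtain ⟨y, hy, hyP⟩ := hσ
  rw [Finset.convexHull_eq] at hx
  obtain ⟨w, hw0, hw1, hwx⟩ := hx
  rw [Finset.centerMass_eq_of_sum_1 _ _ hw1] at hwx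
  have hwpos : ∀ i ∈ σ, 0 < w i := by
    intro i hi
    refine lt_of_le_of_ne (hw0 i hi) fun h0 => hmin (σ.erase i) (Finset.erase_ssubset hi) ?_
    rw [Finset.convexHull_eq]
    have h1 : ∑ j ∈ σ.erase i, w j = 1 := by
      rw [Finset.sum_erase _ h0.symm, hw1]
    refine ⟨w, fun j hj => hw0 j (Finset.mem_of_mem_erase hj), h1, ?_⟩
    rw [Finset.centerMass_eq_of_sum_1 _ _ h1, Finset.sum_erase, hwx]
    rw [← h0]; simp
  rw [Finset.convexHull_eq] at hy
  obtain ⟨v, hv0, hv1, hvy⟩ := hy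
  rw [Finset.centerMass_eq_of_sum_1 _ _ hv1] at hvy
  have hne : σ.Nonempty := by
    by_contra h
    rw [Finset.not_nonempty_iff_eq_empty] at h
    simp [h] at hw1
  obtain ⟨j, hj, hjmin⟩ := Finset.exists_min_image σ w hne
  have hvle : ∀ i ∈ σ, v i ≤ 1 := fun i hi => hv1 ▸ Finset.single_le_sum hv0 hi
  -- All weights of `x` are at least `ε` and those of `y` are at most 1, so the segment from `y` can
  -- be prolonged past `x` by the factor `ε` within the simplex. This places `x` strictly between an
  -- interior point and a point of `P`.
  set ε := w j
  have hε : 0 < ε := hwpos j hj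
  have hz : x + ε • (x - y) ∈ convexHull ℝ (σ : Set Space3) := by
    rw [Finset.convexHull_eq]
    have h1 : ∑ i ∈ σ, (w i + ε * (w i - v i)) = 1 := by
      rw [Finset.sum_add_distrib, ← Finset.mul_sum, Finset.sum_sub_distrib, hw1, hv1]; ring
    refine ⟨fun i => w i + ε * (w i - v i), fun i hi => ?_, h1, ?_⟩
    · have := hjmin i hi
      have := hvle i hi
      have := hwpos i hi
      nlinarith
    · rw [Finset.centerMass_eq_of_sum_1 _ _ h1, ← hwx, ← hvy]
      simp only [id, add_smul, mul_smul, sub_smul, Finset.sum_add_distrib, ← Finset.smul_sum,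
        Finset.sum_sub_distrib]
  refine hP.openSegment_interior_closure_subset_interior hyP (subset_closure (hσP hz)) ?_
  refine ⟨ε / (1 + ε), 1 / (1 + ε), by positivity, by positivity, by field_simp; ring, ?_⟩
  match_scalars <;> field_simp <;> ring

/-! ### Counting tetrahedra by interior edges -/

theorem sum_neg_one_pow_Icc {α : Type*} [DecidableEq α] (A B : Finset α) (h : A ⊆ B) :
    ∑ G ∈ B.powerset, (if A ⊆ G then (-1 : ℤ) ^ (B.card + G.card) else 0) =
      if A = B then 1 else 0 := by
  rw [← Finset.sum_filter]
  have : B.powerset.filter (fun G => A ⊆ G) = ((B \ A).powerset).image (fun X => A ∪ X) := by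
    ext G
    simp only [Finset.mem_filter, Finset.mem_powerset, Finset.mem_image]
    constructor
    · rintro ⟨h1, h2⟩
      exact ⟨G \ A, Finset.sdiff_subset_sdiff h1 subset_rfl, Finset.union_sdiff_of_subset h2⟩
    · rintro ⟨X, hX, rfl⟩
      exact ⟨Finset.union_subset h (hX.trans Finset.sdiff_subset), Finset.subset_union_left⟩
  have hdisj : ∀ X ∈ (B \ A).powerset, Disjoint A X := fun X hX =>
    Finset.disjoint_of_subset_right (Finset.mem_powerset.1 hX) Finset.disjoint_sdiff
  rw [this, Finset.sum_image]
  · have h2 : ∀ X ∈ (B \ A).powerset, (-1 : ℤ) ^ (B.card + (A ∪ X).card) =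
        (-1) ^ (B.card + A.card) * (-1) ^ X.card := by
      intro X hX
      rw [Finset.card_union_of_disjoint (hdisj X hX), ← add_assoc, pow_add]
    rw [Finset.sum_congr rfl h2, ← Finset.mul_sum, Finset.sum_powerset_neg_one_pow_card]
    by_cases hAB : A = B
    · subst hAB
      simp [← two_mul, pow_mul]
    · have : ¬ B ⊆ A := fun h' => hAB (h.antisymm h')
      simp [hAB, this, Finset.sdiff_eq_empty_iff_subset]
  · intro X hX Y hY hXY
    have h1 := hdisj X hX
    have h2 := hdisj Y hY
    dsimp at hXY
    rw [← Finset.union_sdiff_cancel_left h1, hXY, Finset.union_sdiff_cancel_left h2]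

namespace IsTriangulation

variable {P : Set Space3} {T : Finset (Finset Space3)}

theorem subset_extremePoints (hT : IsTriangulation P T) {F : Finset Space3}
    (hF : F ∈ triangulationFaces T) : (F : Set Space3) ⊆ Set.extremePoints ℝ P := by
  obtain ⟨-, t, ht, hFt⟩ := mem_triangulationFaces.1 hF
  exact (Finset.coe_subset.2 hFt).trans (hT.vertices t ht)

theorem mem_triangulationFaces_of_subset {F G : Finset Space3} (hF : F ∈ triangulationFaces T)
    (hG : G ⊆ F) (hG0 : G.Nonempty) : G ∈ triangulationFaces T := by
  obtain ⟨-, t, ht, hFt⟩ := mem_triangulationFaces.1 hF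
  exact mem_triangulationFaces.2 ⟨hG0, t, ht, hG.trans hFt⟩

-- For a fixed `F`, the alternating sum over its subsets is the indicator of the relative interior
-- of `F`, by Möbius inversion. Each point of `P` is in the relative interior of exactly its
-- carrier, and the carrier is an interior face precisely when the point is interior.
open Classical in
theorem indicator_identity (hT : IsTriangulation P T) (hP : Convex ℝ P) (x : Space3) :
    ∑ p ∈ (interiorFaces P T).sigma (fun F => F.powerset),
      (if x ∈ convexHull ℝ (p.2 : Set Space3) then (-1 : ℤ) ^ (p.1.card + p.2.card) else 0) =
      if x ∈ interior P then 1 else 0 := by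
  rw [Finset.sum_sigma]
  by_cases hx : x ∈ P
  · obtain ⟨σ, hσ, hxσ, hmin⟩ := hT.exists_carrier hx
    have hiff : ∀ F ∈ interiorFaces P T, ∀ G ∈ F.powerset,
        (x ∈ convexHull ℝ (G : Set Space3) ↔ σ ⊆ G) := by
      intro F hF G hG
      constructor
      · intro h
        refine hmin G ?_ h
        exact mem_triangulationFaces_of_subset (Finset.mem_filter.1 hF).1
          (Finset.mem_powerset.1 hG) (Finset.coe_nonempty.1 (convexHull_nonempty_iff.1 ⟨x, h⟩))
      · exact fun h => convexHull_mono (by exact_mod_cast h) hxσ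
    have hinner : ∀ F ∈ interiorFaces P T, ∑ G ∈ F.powerset,
        (if x ∈ convexHull ℝ (G : Set Space3) then (-1 : ℤ) ^ (F.card + G.card) else 0) =
        if σ = F then 1 else 0 := by
      intro F hF
      rw [Finset.sum_congr rfl fun G hG => if_congr (hiff F hF G hG) rfl rfl]
      by_cases h : σ ⊆ F
      · exact sum_neg_one_pow_Icc σ F h
      · rw [Finset.sum_eq_zero, if_neg]
        · rintro rfl; exact h subset_rfl
        · intro G hG
          exact if_neg fun h' => h (h'.trans (Finset.mem_powerset.1 hG))
    rw [Finset.sum_congr rfl hinner, Finset.sum_ite_eq]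
    refine if_congr ⟨fun h => ?_, fun h => ?_⟩ rfl rfl
    · refine mem_interior_of_carrier hP (hT.convexHull_subset hσ) hxσ (fun τ hτ hxτ => ?_)
        (Finset.mem_filter.1 h).2
      have := hmin τ (mem_triangulationFaces_of_subset hσ hτ.1
        (Finset.coe_nonempty.1 (convexHull_nonempty_iff.1 ⟨x, hxτ⟩))) hxτ
      exact hτ.2 this
    · exact Finset.mem_filter.2 ⟨hσ, x, hxσ, h⟩
  · rw [if_neg fun h => hx (interior_subset h)]
    refine Finset.sum_eq_zero fun F hF => Finset.sum_eq_zero fun G hG => if_neg fun h => hx ?_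
    exact hT.convexHull_subset (Finset.mem_filter.1 hF).1
      (convexHull_mono (Finset.coe_subset.2 (Finset.mem_powerset.1 hG)) h)

theorem isCompact_convexHull_finset (G : Finset Space3) :
    IsCompact (convexHull ℝ (G : Set Space3)) := G.finite_toSet.isCompact_convexHull ℝ

theorem finrank_space3 : Module.finrank ℝ Space3 = 3 := by simp

/-- The identity expresses the open set `interior P` through compact simplices, so the Euler
relation applies in dimension three. -/
theorem sum_interiorFaces (hT : IsTriangulation P T) (hP : IsConvexPolytope P) :
    ∑ F ∈ interiorFaces P T, (-1 : ℤ) ^ F.card = 1 := by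
  classical
  have h := eulerRelation 3 finrank_space3
    ((interiorFaces P T).sigma (fun F => F.powerset)) (fun p => (-1 : ℤ) ^ (p.1.card + p.2.card))
    (fun p => convexHull ℝ (p.2 : Set Space3)) (fun p _ => isCompact_convexHull_finset p.2)
    (fun p _ => convex_convexHull ℝ _) (interior P) isOpen_interior hP.convex.interior
    (hP.isCompact.isBounded.subset interior_subset) 1
    (fun x => by convert hT.indicator_identity hP.convex x)
  rw [if_pos hP.2, Finset.sum_sigma] at h
  have hinner : ∀ F ∈ interiorFaces P T, ∑ G ∈ F.powerset,
      (if (convexHull ℝ (G : Set Space3)).Nonempty then (-1 : ℤ) ^ (F.card + G.card) else 0) =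
      -(-1) ^ F.card := by
    intro F hF
    have hF0 : F ≠ ∅ := Finset.nonempty_iff_ne_empty.1
      (mem_triangulationFaces.1 (Finset.mem_filter.1 hF).1).1
    -- The full alternating sum over subsets of `F` vanishes. Requiring a nonempty hull drops the
    -- single term `G = ∅`, equal to `(-1) ^ F.card`.
    have h1 := sum_neg_one_pow_Icc ∅ F (Finset.empty_subset F)
    simp only [Finset.empty_subset, if_true, if_neg hF0.symm] at h1
    have h2 : ∑ G ∈ F.powerset, (if G = ∅ then (-1 : ℤ) ^ (F.card + G.card) else 0) =
        (-1) ^ F.card := by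
      rw [Finset.sum_ite_eq' F.powerset ∅]; simp
    rw [← h2, eq_neg_iff_add_eq_zero, ← Finset.sum_add_distrib]
    refine Eq.trans ?_ h1
    refine Finset.sum_congr rfl fun G _ => ?_
    simp only [convexHull_nonempty_iff, Finset.coe_nonempty, Finset.nonempty_iff_ne_empty]
    by_cases hG : G = ∅ <;> simp [hG]
  rw [Finset.sum_congr rfl hinner, Finset.sum_neg_distrib] at h
  linarith

/-- A linear functional and a level separating one vertex from the others. -/
theorem exists_separating (hP : IsConvexPolytope P) {v : Space3}
    (hv : v ∈ Set.extremePoints ℝ P) :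
    ∃ (l : Space3 →L[ℝ] ℝ) (s : ℝ), s < l v ∧ ∀ u ∈ Set.extremePoints ℝ P, u ≠ v → l u < s := by
  have hfin : (Set.extremePoints ℝ P \ {v}).Finite := hP.finite_extremePoints.subset
    Set.sdiff_subset
  have hnot : v ∉ convexHull ℝ (Set.extremePoints ℝ P \ {v}) := by
    intro h
    have h1 : convexHull ℝ (Set.extremePoints ℝ P \ {v}) ⊆ P :=
      hP.convex.convexHull_subset_iff.2 (Set.sdiff_subset.trans extremePoints_subset)
    exact (mem_of_mem_extremePoints_of_mem_convexHull hv h1 h).2 rfl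
  obtain ⟨l, s, h1, h2⟩ := geometric_hahn_banach_closed_point (convex_convexHull ℝ _)
    (hfin.isCompact_convexHull ℝ).isClosed hnot
  exact ⟨l, s, h2, fun u hu huv => h1 u (subset_convexHull ℝ _ ⟨hu, huv⟩)⟩

theorem mem_image_convexHull_iff {X : Set Space3} {v : Space3} {l : Space3 →L[ℝ] ℝ} {s : ℝ}
    (h1 : s < l v) (h2 : ∀ u ∈ X, u ≠ v → l u < s) {G : Finset Space3} (hG : (G : Set Space3) ⊆ X) :
    s ∈ l '' convexHull ℝ (G : Set Space3) ↔ v ∈ G ∧ G ≠ {v} := by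
  constructor
  · rintro ⟨x, hx, hxs⟩
    constructor
    · by_contra hvG
      have : convexHull ℝ (G : Set Space3) ⊆ {x | l x < s} := by
        refine convexHull_min (fun u hu => h2 u (hG hu) ?_)
          (convex_halfSpace_lt l.toLinearMap.isLinear s)
        rintro rfl; exact hvG hu
      exact (this hx).ne hxs
    · rintro rfl
      simp only [Finset.coe_singleton, convexHull_singleton, Set.mem_singleton_iff] at hx
      rw [hx] at hxs
      exact h1.ne' hxs
  · rintro ⟨hvG, hG1⟩
    obtain ⟨u, hu, huv⟩ : ∃ u ∈ G, u ≠ v := by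
      by_contra! h
      exact hG1 (Finset.eq_singleton_iff_unique_mem.2 ⟨hvG, h⟩)
    have hlu := h2 u (hG hu) huv
    have hconv : Convex ℝ (l '' convexHull ℝ (G : Set Space3)) :=
      (convex_convexHull ℝ _).is_linear_image l.toLinearMap.isLinear
    exact hconv.ordConnected.out ⟨u, subset_convexHull ℝ _ hu, rfl⟩
      ⟨v, subset_convexHull ℝ _ hvG, rfl⟩ ⟨hlu.le, h1.le⟩

theorem not_isInteriorFace_singleton {v : Space3}
    (hv : v ∈ Set.extremePoints ℝ P) : ¬ IsInteriorFace P {v} := by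
  rintro ⟨x, hx, hxP⟩
  simp only [Finset.coe_singleton, convexHull_singleton, Set.mem_singleton_iff] at hx
  subst hx
  obtain ⟨w, hw⟩ := exists_ne (0 : Space3)
  have hcont : Continuous fun s : ℝ => x + s • w := by fun_prop
  have h0 : (fun s : ℝ => x + s • w) ⁻¹' (interior P) ∈ 𝓝 (0 : ℝ) :=
    (isOpen_interior.preimage hcont).mem_nhds (by simpa using hxP)
  obtain ⟨ε, hε, hball⟩ := Metric.mem_nhds_iff.1 h0
  have m1 : x + (ε / 2) • w ∈ P := interior_subset
    (hball (by simp [abs_of_pos hε]; linarith : ε / 2 ∈ Metric.ball (0 : ℝ) ε))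
  have m2 : x + (-(ε / 2)) • w ∈ P := interior_subset
    (hball (by simp [abs_of_pos hε]; linarith : -(ε / 2) ∈ Metric.ball (0 : ℝ) ε))
  have := hv.2 m1 m2 ⟨1 / 2, 1 / 2, by norm_num, by norm_num, by norm_num, by module⟩
  have h3 : (ε / 2) • w = 0 := by simpa using this
  rcases smul_eq_zero.1 h3 with h | h
  · linarith
  · exact hw h

/-- A plane separating `v` from the other vertices meets exactly the simplices that contain `v` and
another vertex. The two-dimensional relation in this plane is the Euler relation of the vertex
figure. -/
theorem sum_interiorFaces_mem (hT : IsTriangulation P T) (hP : IsConvexPolytope P) {v : Space3}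
    (hv : v ∈ Set.extremePoints ℝ P) :
    ∑ F ∈ interiorFaces P T, (if v ∈ F then (-1 : ℤ) ^ F.card else 0) = 1 := by
  classical
  obtain ⟨l, s, hs, hl⟩ := exists_separating hP hv
  -- The interior is dense in `P`, so it has points near `v` above the level and points near another
  -- vertex below it.
  have hrange : s ∈ l '' interior P := by
    have hex : ∃ u ∈ Set.extremePoints ℝ P, u ≠ v := by
      by_contra! h
      have h1 : Set.extremePoints ℝ P ⊆ {v} := fun u hu => h u hu
      have h2 : P ⊆ {v} := by
        rw [← hP.convexHull_extremePoints]
        exact (convexHull_mono h1).trans (by simp)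
      obtain ⟨x, hx⟩ := hP.2
      have := interior_mono h2 hx
      simp at this
    obtain ⟨u, hu, huv⟩ := hex
    have hcl : closure (interior P) = P := by
      rw [hP.convex.closure_interior_eq_closure_of_nonempty_interior hP.2,
        hP.isCompact.isClosed.closure_eq]
    have hmem : ∀ x ∈ P, x ∈ closure (interior P) := fun x hx => by rwa [hcl]
    obtain ⟨a, ha, haP⟩ := mem_closure_iff.1 (hmem v hv.1) {x | s < l x}
      (isOpen_lt continuous_const l.continuous) hs
    obtain ⟨b, hb, hbP⟩ := mem_closure_iff.1 (hmem u hu.1) {x | l x < s}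
      (isOpen_lt l.continuous continuous_const) (hl u hu huv)
    have hconv : Convex ℝ (l '' interior P) :=
      hP.convex.interior.is_linear_image l.toLinearMap.isLinear
    exact hconv.ordConnected.out ⟨b, hbP, rfl⟩ ⟨a, haP, rfl⟩ ⟨le_of_lt hb, le_of_lt ha⟩
  have hl0 : l ≠ 0 := by
    rintro rfl
    obtain ⟨x, -, hx⟩ := hrange
    simp at hx hs
    linarith
  have h := EulerRelation.slice (eulerRelation 2) finrank_space3
    ((interiorFaces P T).sigma (fun F => F.powerset)) (fun p => (-1 : ℤ) ^ (p.1.card + p.2.card))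
    (fun p => convexHull ℝ (p.2 : Set Space3)) (fun p _ => isCompact_convexHull_finset p.2)
    (fun p _ => convex_convexHull ℝ _) (interior P) isOpen_interior hP.convex.interior
    (hP.isCompact.isBounded.subset interior_subset) 1
    (fun x => by convert hT.indicator_identity hP.convex x) l hl0 s
  rw [if_pos hrange, Finset.sum_sigma] at h
  norm_num only at h
  refine Eq.trans (Finset.sum_congr rfl fun F hF => ?_) h
  have hF' := (Finset.mem_filter.1 hF).1
  have hsub := hT.subset_extremePoints hF'
  have hFv : F ≠ {v} := by
    rintro rfl
    exact not_isInteriorFace_singleton hv (Finset.mem_filter.1 hF).2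
  have hiff : ∀ G ∈ F.powerset, (s ∈ l '' convexHull ℝ (G : Set Space3) ↔ v ∈ G ∧ G ≠ {v}) :=
    fun G hG => mem_image_convexHull_iff hs hl
      ((Finset.coe_subset.2 (Finset.mem_powerset.1 hG)).trans hsub)
  rw [Finset.sum_congr rfl fun G hG => if_congr (hiff G hG) rfl rfl]
  by_cases hvF : v ∈ F
  · rw [if_pos hvF]
    -- The sum over all subsets of `F` containing `v` vanishes, since `F ≠ {v}`. The plane misses
    -- only `G = {v}`, whose term is `-(-1) ^ F.card`.
    have h1 := sum_neg_one_pow_Icc {v} F (Finset.singleton_subset_iff.2 hvF)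
    rw [if_neg hFv.symm] at h1
    have h2 : ∑ G ∈ F.powerset, (if G = {v} then (-1 : ℤ) ^ (F.card + G.card) else 0) =
        -(-1) ^ F.card := by
      rw [Finset.sum_ite_eq' F.powerset {v}]
      simp [hvF, pow_succ]
    have h3 : ∑ G ∈ F.powerset, (if v ∈ G ∧ G ≠ {v} then (-1 : ℤ) ^ (F.card + G.card) else 0) +
        ∑ G ∈ F.powerset, (if G = {v} then (-1 : ℤ) ^ (F.card + G.card) else 0) = 0 := by
      rw [← Finset.sum_add_distrib]
      refine Eq.trans (Finset.sum_congr rfl fun G _ => ?_) h1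
      by_cases hG : G = {v} <;> simp [hG]
    rw [h2] at h3
    linarith
  · rw [if_neg hvF, Finset.sum_eq_zero]
    intro G hG
    exact if_neg fun h' => hvF (Finset.mem_powerset.1 hG h'.1)

theorem card_le_four (hT : IsTriangulation P T) {F : Finset Space3}
    (hF : F ∈ triangulationFaces T) : F.card ≤ 4 := by
  obtain ⟨-, t, ht, hFt⟩ := mem_triangulationFaces.1 hF
  exact (Finset.card_le_card hFt).trans_eq (hT.card_eq t ht)

theorem isInteriorFace_of_mem (hT : IsTriangulation P T) {t : Finset Space3} (ht : t ∈ T) :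
    IsInteriorFace P t := by
  have hspan : affineSpan ℝ (Set.range ((↑) : t → Space3)) = ⊤ := by
    rw [(hT.indep t ht).affineSpan_eq_top_iff_card_eq_finrank_add_one]
    simp [hT.card_eq t ht]
  have h1 : (interior (convexHull ℝ (t : Set Space3))).Nonempty := by
    rw [interior_convexHull_nonempty_iff_affineSpan_eq_top]
    simpa using hspan
  obtain ⟨x, hx⟩ := h1
  refine ⟨x, interior_subset hx, interior_mono ?_ hx⟩
  rw [← hT.cover]
  exact Set.subset_biUnion_of_mem (u := fun t : Finset Space3 => convexHull ℝ (t : Set Space3)) ht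

open Classical in
/-- The number of tetrahedra in terms of vertices and interior edges. -/
theorem card_add_three (hT : IsTriangulation P T) (hP : IsConvexPolytope P) :
    (T.card : ℤ) + 3 = (Set.extremePoints ℝ P).ncard +
      ((interiorFaces P T).filter fun F => F.card = 2).card := by
  have hfin := hP.finite_extremePoints
  set V := hfin.toFinset with hV
  have hsum : ∑ v ∈ V, ∑ F ∈ interiorFaces P T, (if v ∈ F then (-1 : ℤ) ^ F.card else 0) =
      V.card := by
    rw [Finset.sum_congr rfl fun v hv => hT.sum_interiorFaces_mem hP (hfin.mem_toFinset.1 hv)]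
    simp [hV]
  rw [Finset.sum_comm] at hsum
  have hinner : ∀ F ∈ interiorFaces P T, ∑ v ∈ V, (if v ∈ F then (-1 : ℤ) ^ F.card else 0) =
      F.card * (-1) ^ F.card := by
    intro F hF
    rw [← Finset.sum_filter]
    have : V.filter (fun v => v ∈ F) = F := by
      ext v
      rw [Finset.mem_filter, hfin.mem_toFinset]
      exact ⟨fun h => h.2, fun h => ⟨hT.subset_extremePoints (Finset.mem_filter.1 hF).1 h, h⟩⟩
    rw [this]; simp
  rw [Finset.sum_congr rfl hinner] at hsum
  have htot := hT.sum_interiorFaces hP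
  have hTeq : T = (interiorFaces P T).filter fun F => F.card = 4 := by
    ext t
    constructor
    · intro ht
      have hc := hT.card_eq t ht
      refine Finset.mem_filter.2 ⟨Finset.mem_filter.2 ⟨mem_triangulationFaces.2
        ⟨Finset.card_pos.1 (by omega), t, ht, subset_rfl⟩, hT.isInteriorFace_of_mem ht⟩, hc⟩
    · intro h
      obtain ⟨h1, h2⟩ := Finset.mem_filter.1 h
      obtain ⟨-, t', ht', hsub⟩ := mem_triangulationFaces.1 (Finset.mem_filter.1 h1).1
      rwa [Finset.eq_of_subset_of_card_le hsub (by rw [hT.card_eq t' ht', h2])]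
  have hcard : (Set.extremePoints ℝ P).ncard = V.card := Set.ncard_eq_toFinset_card _ hfin
  rw [hcard]
  have h4 : (T.card : ℤ) = ∑ F ∈ interiorFaces P T, if F.card = 4 then 1 else 0 := by
    rw [← Finset.sum_filter, ← hTeq]; simp
  have h2 : (((interiorFaces P T).filter fun F => F.card = 2).card : ℤ) =
      ∑ F ∈ interiorFaces P T, if F.card = 2 then 1 else 0 := by
    rw [← Finset.sum_filter]; simp
  rw [h4, h2, ← hsum, ← sub_eq_iff_eq_add', ← sub_eq_zero]
  -- Writing 3 as three times the global sum turns the claim into one that holds face by face, for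
  -- cardinalities 2, 3 and 4; triangles cancel.
  have h3 : (3 : ℤ) = 3 * ∑ F ∈ interiorFaces P T, (-1 : ℤ) ^ F.card := by rw [htot]; ring
  rw [h3, Finset.mul_sum, ← Finset.sum_add_distrib, ← Finset.sum_sub_distrib,
    ← Finset.sum_sub_distrib]
  refine Finset.sum_eq_zero fun F hF => ?_
  have hF' := (Finset.mem_filter.1 hF).1
  have hle := hT.card_le_four hF'
  have hpos := Finset.card_pos.2 (mem_triangulationFaces.1 hF').1
  have hne1 : F.card ≠ 1 := by
    intro h1
    obtain ⟨v, rfl⟩ := Finset.card_eq_one.1 h1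
    exact not_isInteriorFace_singleton (hT.subset_extremePoints hF' (by simp))
      (Finset.mem_filter.1 hF).2
  have : F.card = 2 ∨ F.card = 3 ∨ F.card = 4 := by omega
  rcases this with h | h | h <;> rw [h] <;> norm_num

end IsTriangulation

/-! ### Facets cover the boundary of a polytope -/

theorem not_const_on_of_interior_nonempty {P : Set Space3} (hP : (interior P).Nonempty)
    {g : Space3 →L[ℝ] ℝ} (hg : g ≠ 0) (c : ℝ) : ∃ x ∈ P, g x ≠ c := by
  by_contra! h
  have ho := g.isOpenMap_of_ne_zero hg _ (isOpen_interior (s := P))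
  obtain ⟨x, hx⟩ := hP
  have hsub : g '' interior P ⊆ {c} := by
    rintro _ ⟨y, hy, rfl⟩; exact h y (interior_subset hy)
  have := interior_mono hsub (ho.interior_eq.symm ▸ ⟨x, hx, rfl⟩ : g x ∈ interior (g '' interior P))
  simp at this

theorem IsConvexPolytope.le_of_extremePoints {P : Set Space3} (hP : IsConvexPolytope P)
    {l : Space3 →L[ℝ] ℝ} {c : ℝ} (h : ∀ v ∈ Set.extremePoints ℝ P, l v ≤ c) :
    ∀ x ∈ P, l x ≤ c := by
  rw [← hP.convexHull_extremePoints]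
  exact fun x hx => convexHull_min (t := {x | l x ≤ c}) h
    (convex_halfSpace_le l.toLinearMap.isLinear c) hx

/-- A supporting plane whose face has dimension at most one can be turned about that face until it
hits a further vertex. Adding a multiple of a functional that is constant on the face keeps the old
face, and the new vertex enlarges its span. -/
theorem finrank_vectorSpan_lt_of_rotate {P : Set Space3} (hP : IsConvexPolytope P) {z : Space3}
    (hz : z ∈ P) {l : Space3 →L[ℝ] ℝ} (hl0 : l ≠ 0) (hl : ∀ y ∈ P, l y ≤ l z)
    (hW : Module.finrank ℝ (vectorSpan ℝ {x ∈ P | l x = l z}) ≤ 1) :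
    ∃ l' : Space3 →L[ℝ] ℝ, l' ≠ 0 ∧ (∀ y ∈ P, l' y ≤ l' z) ∧
      Module.finrank ℝ (vectorSpan ℝ {x ∈ P | l x = l z}) <
      Module.finrank ℝ (vectorSpan ℝ {x ∈ P | l' x = l' z}) := by
  classical
  set W := vectorSpan ℝ {x ∈ P | l x = l z} with hWdef
  have hWmem : ∀ x ∈ P, l x = l z → x - z ∈ W := fun x hx hxl =>
    vsub_mem_vectorSpan ℝ (s := {x ∈ P | l x = l z}) ⟨hx, hxl⟩ ⟨hz, rfl⟩
  have hWker : W ≤ LinearMap.ker (l : Space3 →ₗ[ℝ] ℝ) := by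
    rw [hWdef, vectorSpan_def, Submodule.span_le]
    rintro _ ⟨x, hx, y, hy, rfl⟩
    simp [hx.2, hy.2]
  have hker : Module.finrank ℝ (LinearMap.ker (l : Space3 →ₗ[ℝ] ℝ)) = 2 := by
    have h0 : (l : Space3 →ₗ[ℝ] ℝ) ≠ 0 := fun h => hl0 (by ext x; simpa using LinearMap.congr_fun h x)
    have := Module.Dual.finrank_ker_add_one_of_ne_zero h0
    simp at this
    omega
  obtain ⟨d, hd, hdW⟩ : ∃ d ∈ LinearMap.ker (l : Space3 →ₗ[ℝ] ℝ), d ∉ W := by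
    by_contra! h
    have := Submodule.finrank_mono (R := ℝ) (s := LinearMap.ker (l : Space3 →ₗ[ℝ] ℝ)) (t := W) h
    omega
  obtain ⟨g0, hg0d, hg0W⟩ := Submodule.exists_le_ker_of_notMem hdW
  have hld : l d = 0 := hd
  -- The sign of `g` is chosen so that some vertex lies above `z`; one of the signs works since `g`
  -- is not constant on `P`.
  obtain ⟨g, hgd, hgW, v1, hv1, hgv1⟩ : ∃ g : Space3 →L[ℝ] ℝ, g d ≠ 0 ∧ (∀ w ∈ W, g w = 0) ∧
      ∃ v ∈ Set.extremePoints ℝ P, g z < g v := by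
    let g : Space3 →L[ℝ] ℝ := LinearMap.toContinuousLinearMap g0
    have hg1 : g d ≠ 0 := hg0d
    have hg2 : ∀ w ∈ W, g w = 0 := fun w hw => hg0W hw
    by_cases h1 : ∃ v ∈ Set.extremePoints ℝ P, g z < g v
    · exact ⟨g, hg1, hg2, h1⟩
    · refine ⟨-g, by simpa using hg1, fun w hw => by simp [hg2 w hw], ?_⟩
      by_contra! h2
      push Not at h1
      obtain ⟨x, hx, hxz⟩ := not_const_on_of_interior_nonempty hP.2
        (fun h => hg1 (by simp [h]) : g ≠ 0) (g z)
      have h3 := hP.le_of_extremePoints h1 x hx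
      have h4 := hP.le_of_extremePoints h2 x hx
      simp at h4
      exact hxz (le_antisymm h3 h4)
  have hgF : ∀ x ∈ P, l x = l z → g x = g z := fun x hx hxl => by
    have := hgW _ (hWmem x hx hxl)
    rwa [map_sub, sub_eq_zero] at this
  have hfin := hP.finite_extremePoints
  -- `v0` is the first vertex reached by the turning plane: for the smallest of these ratios `l + s
  -- • g` is still maximal at `z`.
  obtain ⟨v0, hv0, hmin⟩ := Finset.exists_min_image (hfin.toFinset.filter fun v => g z < g v)
    (fun v => (l z - l v) / (g v - g z))
    ⟨v1, Finset.mem_filter.2 ⟨hfin.mem_toFinset.2 hv1, hgv1⟩⟩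
  simp only [Finset.mem_filter, Set.Finite.mem_toFinset] at hv0 hmin
  have hlt : ∀ v ∈ Set.extremePoints ℝ P, g z < g v → l v < l z := by
    intro v hv hgv
    refine lt_of_le_of_ne (hl v hv.1) fun h => ?_
    rw [hgF v hv.1 h] at hgv
    exact lt_irrefl _ hgv
  set s := (l z - l v0) / (g v0 - g z) with hs
  have hspos : 0 < s := div_pos (sub_pos.2 (hlt v0 hv0.1 hv0.2)) (sub_pos.2 hv0.2)
  have hv0eq : (l + s • g) v0 = (l + s • g) z := by
    have : g v0 - g z ≠ 0 := (sub_pos.2 hv0.2).ne'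
    have : s * (g v0 - g z) = l z - l v0 := by rw [hs]; field_simp
    simp; linarith
  refine ⟨l + s • g, fun h => ?_, ?_, ?_⟩
  · have := DFunLike.congr_fun h d
    simp [hld, hspos.ne', hgd] at this
  · apply hP.le_of_extremePoints
    intro v hv
    change l v + s * g v ≤ l z + s * g z
    by_cases hgv : g z < g v
    · have := hmin v ⟨hv, hgv⟩
      rw [le_div_iff₀ (sub_pos.2 hgv)] at this
      linarith
    · have := hl v hv.1
      push Not at hgv
      nlinarith
  · apply Submodule.finrank_lt_finrank_of_lt
    refine lt_of_le_of_ne (vectorSpan_mono ℝ fun x hx => ⟨hx.1, ?_⟩) fun h => ?_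
    · simp [hx.2, hgF x hx.1 hx.2]
    · have h1 : v0 - z ∈ W := by
        rw [h]
        exact vsub_mem_vectorSpan ℝ (s := {x ∈ P | (l + s • g) x = (l + s • g) z})
          ⟨hv0.1.1, hv0eq⟩ ⟨hz, rfl⟩
      have h2 : l (v0 - z) = 0 := hWker h1
      have := hlt v0 hv0.1 hv0.2
      rw [map_sub] at h2
      linarith

/-- The boundary of a convex polytope is covered by its facets. -/
theorem IsConvexPolytope.exists_isFacet {P : Set Space3} (hP : IsConvexPolytope P) {z : Space3}
    (hz : z ∈ P) (hzi : z ∉ interior P) : ∃ F, IsFacet P F ∧ z ∈ F := by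
  -- Starting from any supporting plane at `z`, rotations raise the dimension of the face to two.
  have key : ∀ k ≤ 2, ∃ l : Space3 →L[ℝ] ℝ, l ≠ 0 ∧ (∀ y ∈ P, l y ≤ l z) ∧
      k ≤ Module.finrank ℝ (vectorSpan ℝ {x ∈ P | l x = l z}) := by
    intro k
    induction k with
    | zero =>
      intro _
      obtain ⟨l, hl⟩ := geometric_hahn_banach_open_point hP.convex.interior isOpen_interior hzi
      refine ⟨l, ?_, fun y hy => ?_, Nat.zero_le _⟩
      · rintro rfl
        obtain ⟨a, ha⟩ := hP.2
        simpa using hl a ha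
      · have hcl : y ∈ closure (interior P) := by
          rw [hP.convex.closure_interior_eq_closure_of_nonempty_interior hP.2]
          exact subset_closure hy
        exact closure_minimal (t := {y | l y ≤ l z}) (fun a ha => (hl a ha).le)
          (isClosed_le l.continuous continuous_const) hcl
    | succ k ih =>
      intro hk
      obtain ⟨l, hl0, hl, hlk⟩ := ih (by omega)
      by_cases h : k + 1 ≤ Module.finrank ℝ (vectorSpan ℝ {x ∈ P | l x = l z})
      · exact ⟨l, hl0, hl, h⟩
      · obtain ⟨l', hl0', hl', hlt⟩ := finrank_vectorSpan_lt_of_rotate hP hz hl0 hl (by omega)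
        exact ⟨l', hl0', hl', by omega⟩
  obtain ⟨l, hl0, hl, hlk⟩ := key 2 le_rfl
  refine ⟨{x ∈ P | l x = l z}, ⟨fun _ => ⟨l, ?_⟩, le_antisymm ?_ hlk⟩, hz, rfl⟩
  · ext x
    constructor
    · rintro ⟨hx, hxl⟩
      exact ⟨hx, fun y hy => (hl y hy).trans_eq hxl.symm⟩
    · rintro ⟨hx, hxl⟩
      exact ⟨hx, le_antisymm (hl x hx) (hxl z hz)⟩
  · have h0 : (l : Space3 →ₗ[ℝ] ℝ) ≠ 0 := fun h => hl0 (by ext x; simpa using LinearMap.congr_fun h x)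
    have hker := Module.Dual.finrank_ker_add_one_of_ne_zero h0
    simp at hker
    have hle : vectorSpan ℝ {x ∈ P | l x = l z} ≤ LinearMap.ker (l : Space3 →ₗ[ℝ] ℝ) := by
      rw [vectorSpan_def, Submodule.span_le]
      rintro _ ⟨x, hx, y, hy, rfl⟩
      simp [hx.2, hy.2]
    have := Submodule.finrank_mono (R := ℝ) hle
    omega

/-! ### Determinants and convex position -/

/-- The determinant of three vectors of `Space3`. -/
def det3 (x y z : Space3) : ℝ :=
  x 0 * (y 1 * z 2 - y 2 * z 1) - x 1 * (y 0 * z 2 - y 2 * z 0) + x 2 * (y 0 * z 1 - y 1 * z 0)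

theorem det3_cramer (x y z w : Space3) :
    det3 x y z • w = det3 w y z • x + det3 x w z • y + det3 x y w • z := by
  ext i
  fin_cases i <;> simp [det3] <;> ring

theorem det3_rotate (x y z : Space3) : det3 x y z = det3 y z x := by simp [det3]; ring

theorem det3_swap (x y z : Space3) : det3 x y z = -det3 y x z := by simp [det3]; ring

theorem det3_swap' (x y z : Space3) : det3 x y z = -det3 x z y := by simp [det3]; ring

theorem det3_self_left (x y : Space3) : det3 x y x = 0 := by simp [det3]; ring

theorem det3_self_right (x y : Space3) : det3 x y y = 0 := by simp [det3]; ring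

theorem det3_add (x y z w : Space3) : det3 x y (z + w) = det3 x y z + det3 x y w := by
  simp [det3]; ring

theorem det3_smul (x y z : Space3) (c : ℝ) : det3 x y (c • z) = c * det3 x y z := by
  simp [det3]; ring

theorem det3_plucker (a p k l n : Space3) :
    det3 a p l * det3 a k n = det3 a p k * det3 a l n + det3 a p n * det3 a k l := by
  simp only [det3]; ring

/-- The determinant as a linear functional of its last argument. -/
noncomputable def det3L (x y : Space3) : Space3 →L[ℝ] ℝ :=
  LinearMap.toContinuousLinearMap
    { toFun := det3 x y
      map_add' := det3_add x y
      map_smul' := fun c z => det3_smul x y z c }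

/-- Both `det3 x y` and `l` vanish on `x` and `y`, so they are proportional; Cramer's identity gives
this without assuming independence. Orientations can thus be read off from supporting functionals.
-/
theorem det3_mul_functional {x y : Space3} {l : Space3 →L[ℝ] ℝ} (hx : l x = 0) (hy : l y = 0)
    (z w : Space3) : det3 x y w * l z = det3 x y z * l w := by
  have := congrArg l (det3_cramer x y w z)
  simpa [hx, hy] using this

theorem det3_pos_iff {x y z w : Space3} {l : Space3 →L[ℝ] ℝ} (hx : l x = 0) (hy : l y = 0)
    (hz : l z < 0) (hw : l w < 0) {σ : ℝ} (h : 0 < σ * det3 x y z) : 0 < σ * det3 x y w := by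
  have h1 := det3_mul_functional hx hy z w
  by_contra! h2
  have h3 : σ * det3 x y w * l z = σ * det3 x y z * l w := by linear_combination σ * h1
  nlinarith [mul_nonneg_of_nonpos_of_nonpos h2 hz.le, mul_pos_of_neg_of_neg
    (neg_lt_zero.2 h) hw]

theorem det3_ne_zero {x y z w : Space3} {l : Space3 →L[ℝ] ℝ} (hx : l x = 0) (hy : l y = 0)
    (hz : l z ≠ 0) (hw : det3 x y w ≠ 0) : det3 x y z ≠ 0 := by
  intro h
  have h1 := det3_mul_functional hx hy z w
  rw [h, zero_mul] at h1
  exact (mul_ne_zero hw hz) h1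

theorem exists_eq_smul_of_det3_eq_zero {x y : Space3} (hx : x ≠ 0) (h : ∀ w, det3 x y w = 0) :
    ∃ t : ℝ, y = t • x := by
  obtain ⟨i, hi⟩ : ∃ i, x i ≠ 0 := by
    by_contra! h0
    exact hx (by ext i; simpa using h0 i)
  refine ⟨y i / x i, ?_⟩
  have h0 := h (EuclideanSpace.single 0 1)
  have h1 := h (EuclideanSpace.single 1 1)
  have h2 := h (EuclideanSpace.single 2 1)
  simp [det3] at h0 h1 h2
  ext j
  simp only [PiLp.smul_apply, smul_eq_mul]
  field_simp
  fin_cases i <;> fin_cases j <;> simp <;> linarith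

/-- If the three points were collinear, one of them would lie strictly between the other two; the
ranges of `t` decide which one. -/
theorem exists_det3_ne_zero {C : Set Space3} {a b c : Space3} (ha : a ∈ Set.extremePoints ℝ C)
    (hb : b ∈ Set.extremePoints ℝ C) (hc : c ∈ Set.extremePoints ℝ C) (hab : a ≠ b) (hac : a ≠ c)
    (hbc : b ≠ c) : ∃ w, det3 (b - a) (c - a) w ≠ 0 := by
  by_contra! h
  obtain ⟨t, ht⟩ := exists_eq_smul_of_det3_eq_zero (sub_ne_zero.2 hab.symm) h
  rw [sub_eq_iff_eq_add] at ht
  have ht0 : t ≠ 0 := by rintro rfl; exact hac (by simp [ht])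
  have ht1 : t ≠ 1 := by rintro rfl; exact hbc (by simp [ht])
  rcases lt_trichotomy t 0 with h0 | h0 | h0
  · refine hab (ha.2 hb.1 hc.1 ?_).symm
    have : (1 - t) ≠ 0 := by linarith
    refine ⟨-t / (1 - t), 1 / (1 - t), div_pos (by linarith) (by linarith),
      div_pos one_pos (by linarith), by field_simp; ring, ?_⟩
    rw [ht]
    match_scalars <;> field_simp <;> ring
  · exact ht0 h0
  rcases lt_trichotomy t 1 with h1 | h1 | h1
  · refine hac (hc.2 ha.1 hb.1 ⟨1 - t, t, by linarith, h0, by ring, ?_⟩)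
    rw [ht]; module
  · exact ht1 h1
  · refine hab (hb.2 ha.1 hc.1 ⟨1 - 1 / t, 1 / t, ?_, by positivity, by ring, ?_⟩)
    · rw [sub_pos, div_lt_one h0]; exact h1
    · rw [ht]
      match_scalars <;> field_simp <;> ring

/-- Vectors in convex position around the origin: if all consecutive pairs span supporting planes,
then all increasing triples have the same orientation. -/
theorem det3_chain {v : ℕ → Space3} {N : ℕ} (hN : 2 ≤ N)
    (hl : ∀ k, k + 1 ≤ N → ∃ l : Space3 →L[ℝ] ℝ, l (v k) = 0 ∧ l (v (k + 1)) = 0 ∧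
      ∀ j ≤ N, j ≠ k → j ≠ k + 1 → l (v j) < 0)
    (hw : ∃ w, det3 (v 0) (v 1) w ≠ 0) :
    ∃ σ : ℝ, ∀ a b c, a < b → b < c → c ≤ N → 0 < σ * det3 (v a) (v b) (v c) := by
  have h012 : det3 (v 0) (v 1) (v 2) ≠ 0 := by
    obtain ⟨w, hw⟩ := hw
    obtain ⟨l, h0, h1, h2⟩ := hl 0 (by omega)
    exact det3_ne_zero h0 h1 (h2 2 hN (by omega) (by omega)).ne hw
  set σ := det3 (v 0) (v 1) (v 2) with hσ
  -- All other vectors lie on one side of the plane of a consecutive pair. The triple `k, k + 1, k +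
  -- 2` belongs to two consecutive pairs and carries the sign from one to the next.
  have hcons : ∀ k, k + 1 ≤ N → ∀ j ≤ N, j ≠ k → j ≠ k + 1 →
      0 < σ * det3 (v k) (v (k + 1)) (v j) := by
    intro k
    induction k with
    | zero =>
      intro h j hj h1 h2
      obtain ⟨l, l0, l1, l2⟩ := hl 0 h
      exact det3_pos_iff l0 l1 (l2 2 hN (by omega) (by omega)) (l2 j hj h1 h2)
        (mul_self_pos.2 h012)
    | succ k ih =>
      intro h j hj h1 h2
      obtain ⟨l, l0, l1, l2⟩ := hl (k + 1) h
      have := ih (by omega) (k + 2) (by omega) (by omega) (by omega)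
      rw [det3_rotate] at this
      exact det3_pos_iff l0 l1 (l2 k (by omega) (by omega) (by omega)) (l2 j hj h1 h2) this
  refine ⟨σ, fun a b c hab hbc hc => ?_⟩
  induction c, hbc using Nat.le_induction with
  | base =>
    rw [det3_rotate]
    exact hcons b hc a (by omega) (by omega) (by omega)
  | succ c hbc ih =>
    have h1 := ih (by omega)
    rcases Nat.eq_or_lt_of_le (Nat.succ_le_of_lt hab) with rfl | hb
    · exact hcons a (by omega) _ hc (by omega) (by omega)
    · have p1 := hcons a (by omega) c (by omega) (by omega) (by omega)
      have p2 := hcons a (by omega) b (by omega) (by omega) (by omega)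
      have p3 := hcons a (by omega) (c + 1) (by omega) (by omega) (by omega)
      have p4 := hcons c (by omega) a (by omega) (by omega) (by omega)
      rw [← det3_rotate] at p4
      -- In this Plücker relation every determinant except the one for `a, b, c + 1` is already
      -- known to have the sign of `σ`.
      have hp := det3_plucker (v a) (v (a + 1)) (v b) (v c) (v (c + 1))
      have hp' : (σ * det3 (v a) (v (a + 1)) (v c)) * (σ * det3 (v a) (v b) (v (c + 1))) =
          (σ * det3 (v a) (v (a + 1)) (v b)) * (σ * det3 (v a) (v c) (v (c + 1))) +
          (σ * det3 (v a) (v (a + 1)) (v (c + 1))) * (σ * det3 (v a) (v b) (v c)) := by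
        linear_combination σ ^ 2 * hp
      have := add_pos (mul_pos p2 p4) (mul_pos p3 h1)
      rw [← hp'] at this
      exact pos_of_mul_pos_right this p1.le

/-! ### Facets and chains of a cupola -/

theorem IsFacet.exists_functional {C F : Set Space3} (h : IsFacet C F) {f : Space3} (hf : f ∈ F) :
    ∃ (l : Space3 →L[ℝ] ℝ) (M : ℝ), (∀ x ∈ C, l x ≤ M) ∧ ∀ x ∈ C, (l x = M ↔ x ∈ F) := by
  obtain ⟨l, hl⟩ := h.1 ⟨f, hf⟩
  have hfC : f ∈ C ∧ ∀ y ∈ C, l y ≤ l f := by rw [hl] at hf; exact hf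
  refine ⟨l, l f, hfC.2, fun x hx => ?_⟩
  rw [hl]
  exact ⟨fun h => ⟨hx, fun y hy => (hfC.2 y hy).trans_eq h.symm⟩,
    fun h => le_antisymm (hfC.2 x hx) (h.2 f hfC.1)⟩

theorem IsFacet.subset {C F : Set Space3} (h : IsFacet C F) : F ⊆ C := IsExposed.subset h.1

/-- The `k`-th vertex of the `i`-th chain, indexed by natural numbers. -/
def chainVertex {m : ℕ} (q : Fin 3 → Fin (m + 2) → Space3) (i : Fin 3) (k : ℕ) : Space3 :=
  q i (Fin.ofNat (m + 2) k)

theorem chainVertex_castSucc {m : ℕ} (q : Fin 3 → Fin (m + 2) → Space3) (i : Fin 3)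
    (k : Fin (m + 1)) : chainVertex q i k = q i k.castSucc := by
  refine congrArg (q i) (Fin.ext ?_)
  simp [Fin.ofNat, Nat.mod_eq_of_lt (show (k : ℕ) < m + 2 by omega)]

theorem chainVertex_succ {m : ℕ} (q : Fin 3 → Fin (m + 2) → Space3) (i : Fin 3)
    (k : Fin (m + 1)) : chainVertex q i (k + 1) = q i k.succ := by
  refine congrArg (q i) (Fin.ext ?_)
  simp [Fin.ofNat, Nat.mod_eq_of_lt (show (k : ℕ) + 1 < m + 2 by omega)]

/-- The vertex sets of the facets of a cupola other than the bottom. -/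
inductive IsUpperTriangle {m : ℕ} (A B : Fin 3 → Space3) (q : Fin 3 → Fin (m + 2) → Space3) :
    Set Space3 → Prop
  | skylight : IsUpperTriangle A B q {B 0, B 1, B 2}
  | left (i : Fin 3) (k : ℕ) (hk : k ≤ m) :
      IsUpperTriangle A B q {B i, chainVertex q i k, chainVertex q i (k + 1)}
  | right (i : Fin 3) (k : ℕ) (hk : k ≤ m) :
      IsUpperTriangle A B q {A (i + 1), chainVertex q i k, chainVertex q i (k + 1)}

theorem range_fin_three (B : Fin 3 → Space3) : Set.range B = {B 0, B 1, B 2} := by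
  ext x
  simp [Fin.exists_fin_succ, eq_comm]

namespace IsCupola

variable {m : ℕ} {A B : Fin 3 → Space3} {q : Fin 3 → Fin (m + 2) → Space3} {C : Set Space3}

theorem chainVertex_zero (hC : IsCupola m A B q C) (i : Fin 3) : A i = chainVertex q i 0 :=
  (hC.chain_zero i).symm

theorem chainVertex_last (hC : IsCupola m A B q C) (i : Fin 3) :
    B i = chainVertex q (i + 2) (m + 1) := by
  have h := hC.chain_last (i + 2)
  have h3 : i + 2 + 1 = i := by clear h; revert i; decide
  rw [h3] at h
  rw [← h, chainVertex]
  congr 1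
  ext
  simp [Fin.ofNat]

theorem chainVertex_inj (hC : IsCupola m A B q C) {i j : Fin 3} {k l : ℕ} (hk : k ≤ m + 1)
    (hl : l ≤ m + 1) : chainVertex q i k = chainVertex q j l ↔ i = j ∧ k = l := by
  constructor
  · intro h
    have := hC.chain_injective (a₁ := (i, Fin.ofNat (m + 2) k)) (a₂ := (j, Fin.ofNat (m + 2) l)) h
    rw [Prod.mk.injEq] at this
    refine ⟨this.1, ?_⟩
    have h2 := congrArg Fin.val this.2
    simpa [Fin.ofNat, Nat.mod_eq_of_lt (show k < m + 2 by omega),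
      Nat.mod_eq_of_lt (show l < m + 2 by omega)] using h2
  · rintro ⟨rfl, rfl⟩; rfl

theorem chainVertex_mem (hC : IsCupola m A B q C) (i : Fin 3) (k : ℕ) :
    chainVertex q i k ∈ Set.extremePoints ℝ C := by
  rw [hC.vertices]
  exact ⟨(i, Fin.ofNat (m + 2) k), rfl⟩

theorem A_mem (hC : IsCupola m A B q C) (i : Fin 3) : A i ∈ Set.extremePoints ℝ C := by
  rw [hC.chainVertex_zero]; exact hC.chainVertex_mem _ _

theorem B_mem (hC : IsCupola m A B q C) (i : Fin 3) : B i ∈ Set.extremePoints ℝ C := by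
  rw [hC.chainVertex_last]; exact hC.chainVertex_mem _ _

theorem isFacet_bottom (hC : IsCupola m A B q C) : IsFacet C (convexHull ℝ (Set.range A)) := by
  have : convexHull ℝ (Set.range A) ∈ {F | IsFacet C F} := by
    rw [hC.facets]; simp
  exact this

theorem isFacet_upper (hC : IsCupola m A B q C) {s : Set Space3} (hs : IsUpperTriangle A B q s) :
    IsFacet C (convexHull ℝ s) := by
  have : convexHull ℝ s ∈ {F | IsFacet C F} := by
    rw [hC.facets]
    rcases hs with _ | ⟨i, k, hk⟩ | ⟨i, k, hk⟩
    · left; right; rw [range_fin_three]; rfl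
    · right; left
      refine ⟨(i, ⟨k, by omega⟩), ?_⟩
      have h1 := chainVertex_castSucc q i ⟨k, by omega⟩
      have h2 := chainVertex_succ q i ⟨k, by omega⟩
      dsimp only at h1 h2 ⊢
      rw [h1, h2]
    · right; right
      refine ⟨(i, ⟨k, by omega⟩), ?_⟩
      have h1 := chainVertex_castSucc q i ⟨k, by omega⟩
      have h2 := chainVertex_succ q i ⟨k, by omega⟩
      dsimp only at h1 h2 ⊢
      rw [h1, h2]
  exact this

theorem eq_of_isFacet (hC : IsCupola m A B q C) {F : Set Space3} (hF : IsFacet C F) :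
    F = convexHull ℝ (Set.range A) ∨ ∃ s, IsUpperTriangle A B q s ∧ F = convexHull ℝ s := by
  have : F ∈ {F | IsFacet C F} := hF
  rw [hC.facets] at this
  rcases this with (h | h) | ⟨⟨i, k⟩, rfl⟩ | ⟨⟨i, k⟩, rfl⟩
  · exact Or.inl h
  · right
    refine ⟨_, .skylight, ?_⟩
    rw [← range_fin_three]; exact h
  · right
    refine ⟨_, .left i k (by omega), ?_⟩
    rw [chainVertex_castSucc, chainVertex_succ]
  · right
    refine ⟨_, .right i k (by omega), ?_⟩
    rw [chainVertex_castSucc, chainVertex_succ]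

theorem upper_subset (hC : IsCupola m A B q C) {s : Set Space3} (hs : IsUpperTriangle A B q s) :
    s ⊆ Set.extremePoints ℝ C := by
  rcases hs with _ | ⟨i, k, hk⟩ | ⟨i, k, hk⟩ <;> rintro x (rfl | rfl | rfl)
  all_goals first | exact hC.B_mem _ | exact hC.A_mem _ | exact hC.chainVertex_mem _ _

end IsCupola

/-! ### The cupola inside the larger polytope -/

/-- A cupola `C` inside a polytope `P`, with a linear functional which cuts `C` off from `P` along
the bottom of `C`. -/
structure IsCupolaIn (m : ℕ) (A B : Fin 3 → Space3) (q : Fin 3 → Fin (m + 2) → Space3)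
    (C P : Set Space3) (φ : Space3 →L[ℝ] ℝ) (γ : ℝ) : Prop where
  cupola : IsCupola m A B q C
  polytope : IsConvexPolytope P
  subset : C ⊆ P
  le : ∀ x ∈ C, φ x ≤ γ
  bottom : ∀ i, φ (A i) = γ
  mem : ∀ x ∈ P, φ x ≤ γ → x ∈ C
  eq : ∀ x ∈ C, φ x = γ → x ∈ convexHull ℝ (Set.range A)

/-- A plane separating `interior C` from `Q` must contain the bottom, which belongs to both `C` and
`Q`. -/
theorem IsCupola.exists_isCupolaIn {m : ℕ} {A B : Fin 3 → Space3}
    {q : Fin 3 → Fin (m + 2) → Space3} {C P Q : Set Space3} (hC : IsCupola m A B q C)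
    (hP : IsConvexPolytope P) (hCP : C ⊆ P) (hQ : IsConvexPolytope Q) (hQPC : Q = closure (P \ C))
    (hQfacet : IsFacet Q (convexHull ℝ (Set.range A))) :
    ∃ φ γ, IsCupolaIn m A B q C P φ γ := by
  have hCp := hC.isConvexPolytope
  have hdisj : Disjoint (interior C) Q := by
    rw [hQPC]
    refine Disjoint.closure_right ?_ isOpen_interior
    rw [Set.disjoint_left]
    exact fun x hx hx' => hx'.2 (interior_subset hx)
  obtain ⟨φ, γ, h1, h2⟩ := geometric_hahn_banach_open hCp.convex.interior isOpen_interior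
    hQ.convex hdisj
  have hle : ∀ x ∈ C, φ x ≤ γ := by
    intro x hx
    have hcl : x ∈ closure (interior C) := by
      rw [hCp.convex.closure_interior_eq_closure_of_nonempty_interior hCp.2]
      exact subset_closure hx
    exact closure_minimal (t := {y | φ y ≤ γ}) (fun a ha => (h1 a ha).le)
      (isClosed_le φ.continuous continuous_const) hcl
  have hbot : ∀ i, φ (A i) = γ := fun i => by
    have hA : A i ∈ convexHull ℝ (Set.range A) := subset_convexHull ℝ _ ⟨i, rfl⟩
    exact le_antisymm (hle _ (hC.isFacet_bottom.subset hA)) (h2 _ (hQfacet.subset hA))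
  obtain ⟨o, ho⟩ := hCp.2
  have hoγ := h1 o ho
  have hmem' : ∀ x ∈ P, φ x < γ → x ∈ C := by
    intro x hx hxγ
    by_contra hxC
    have : x ∈ Q := by rw [hQPC]; exact subset_closure ⟨hx, hxC⟩
    exact absurd (h2 x this) (not_le.2 hxγ)
  refine ⟨φ, γ, hC, hP, hCP, hle, hbot, ?_, ?_⟩
  · intro x hx hxγ
    -- A point at level `γ` is a limit of points on the segment to the interior point `o`; these lie
    -- strictly below `γ`, hence in `C`.
    have hcont : Tendsto (fun t : ℝ => AffineMap.lineMap x o t) (𝓝[>] 0) (𝓝 x) := by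
      have : Continuous fun t : ℝ => (AffineMap.lineMap x o t : Space3) := by fun_prop
      have h0 := this.tendsto 0
      rw [AffineMap.lineMap_apply_zero] at h0
      exact h0.mono_left nhdsWithin_le_nhds
    refine hCp.isCompact.isClosed.mem_of_tendsto hcont ?_
    filter_upwards [Ioo_mem_nhdsGT (zero_lt_one' ℝ)] with t ht
    apply hmem'
    · exact hP.convex.lineMap_mem hx (hCP (interior_subset ho)) ⟨ht.1.le, ht.2.le⟩
    · rw [AffineMap.lineMap_apply_module, map_add, map_smul, map_smul, smul_eq_mul, smul_eq_mul]
      nlinarith [ht.1, ht.2]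
  · intro x hx hxγ
    have hA : ∀ i, A i ∈ convexHull ℝ (Set.range A) := fun i => subset_convexHull ℝ _ ⟨i, rfl⟩
    obtain ⟨l, M, hl, hlM⟩ := hC.isFacet_bottom.exists_functional (hA 0)
    have hAM : ∀ i, l (A i) = M := fun i => (hlM _ (hC.A_mem i).1).2 (hA i)
    rw [← hlM x hx]
    -- A point off the plane of the bottom would span space together with the `A i`, making `φ`
    -- constantly `γ`, contrary to `φ o < γ`.
    by_contra hne
    have hinj : ∀ i j, i ≠ j → A i ≠ A j := by
      intro i j hij h
      rw [hC.chainVertex_zero, hC.chainVertex_zero, hC.chainVertex_inj (by omega) (by omega)] at h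
      exact hij h.1
    obtain ⟨w, hw⟩ := exists_det3_ne_zero (hC.A_mem 0) (hC.A_mem 1) (hC.A_mem 2)
      (hinj _ _ (by decide)) (hinj _ _ (by decide)) (hinj _ _ (by decide))
    have hd : det3 (A 1 - A 0) (A 2 - A 0) (x - A 0) ≠ 0 :=
      det3_ne_zero (l := l) (by simp [hAM]) (by simp [hAM])
        (by rw [map_sub, hAM]; exact sub_ne_zero.2 hne) hw
    have hz := congrArg φ (det3_cramer (A 1 - A 0) (A 2 - A 0) (x - A 0) (o - A 0))
    simp [hbot, hxγ, hd] at hz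
    linarith

namespace IsCupolaIn

variable {m : ℕ} {A B : Fin 3 → Space3} {q : Fin 3 → Fin (m + 2) → Space3} {C P : Set Space3}
  {φ : Space3 →L[ℝ] ℝ} {γ : ℝ}

theorem chainVertex_lt (h : IsCupolaIn m A B q C P φ γ) (i : Fin 3) {k : ℕ} (hk : k ≠ 0)
    (hkm : k ≤ m + 1) : φ (chainVertex q i k) < γ := by
  have hm := h.cupola.chainVertex_mem i k
  refine lt_of_le_of_ne (h.le _ hm.1) fun he => ?_
  have h1 := mem_of_mem_extremePoints_of_mem_convexHull hm h.cupola.isFacet_bottom.subset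
    (h.eq _ hm.1 he)
  obtain ⟨j, hj⟩ := h1
  rw [h.cupola.chainVertex_zero, h.cupola.chainVertex_inj (by omega) hkm] at hj
  exact hk hj.2.symm

theorem B_lt (h : IsCupolaIn m A B q C P φ γ) (i : Fin 3) : φ (B i) < γ := by
  rw [h.cupola.chainVertex_last]
  exact h.chainVertex_lt _ (by omega) le_rfl

/-- A functional maximized over `C` at a point off the bottom is maximized there over `P`. -/
theorem le_of_le (h : IsCupolaIn m A B q C P φ γ) {l : Space3 →L[ℝ] ℝ} {f : Space3} (hf : f ∈ C)
    (hfγ : φ f < γ) (hl : ∀ x ∈ C, l x ≤ l f) : ∀ x ∈ P, l x ≤ l f := by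
  intro x hx
  have hcont : Tendsto (fun t : ℝ => φ (AffineMap.lineMap f x t)) (𝓝[>] 0) (𝓝 (φ f)) := by
    have : Continuous fun t : ℝ => φ (AffineMap.lineMap f x t) := by fun_prop
    have h0 := this.tendsto 0
    rw [AffineMap.lineMap_apply_zero] at h0
    exact h0.mono_left nhdsWithin_le_nhds
  -- Near `f` the segment towards `x` stays below `γ`, hence in `C`. An affine function not above
  -- its initial value at such a point is not above it at the end.
  obtain ⟨t, ht, ht2⟩ := ((hcont.eventually (gt_mem_nhds hfγ)).and
    (Ioo_mem_nhdsGT (zero_lt_one' ℝ))).exists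
  have hC := h.mem _ (h.polytope.convex.lineMap_mem (h.subset hf) hx ⟨ht2.1.le, ht2.2.le⟩) ht.le
  have := hl _ hC
  rw [AffineMap.lineMap_apply_module, map_add, map_smul, map_smul, smul_eq_mul, smul_eq_mul] at this
  nlinarith [ht2.1]

theorem exists_functional (h : IsCupolaIn m A B q C P φ γ) {s : Set Space3}
    (hs : IsUpperTriangle A B q s) {f : Space3} (hf : f ∈ convexHull ℝ s) (hfγ : φ f < γ) :
    ∃ (l : Space3 →L[ℝ] ℝ) (M : ℝ), (∀ x ∈ P, l x ≤ M) ∧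
      ∀ x ∈ C, (l x = M ↔ x ∈ convexHull ℝ s) := by
  have hF := h.cupola.isFacet_upper hs
  obtain ⟨l, M, hl, hlM⟩ := hF.exists_functional hf
  have hfC := hF.subset hf
  have hfM := (hlM f hfC).2 hf
  refine ⟨l, M, ?_, hlM⟩
  rw [← hfM]
  exact h.le_of_le hfC hfγ (by rwa [hfM])

theorem mem_upper_of_mem (h : IsCupolaIn m A B q C P φ γ) {s : Set Space3}
    (hs : IsUpperTriangle A B q s) {x : Space3} (hx : x ∈ Set.extremePoints ℝ P)
    (hxs : x ∈ convexHull ℝ s) : x ∈ s :=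
  mem_of_mem_extremePoints_of_mem_convexHull hx
    ((h.cupola.isFacet_upper hs).subset.trans h.subset) hxs

theorem exists_crossing {u v : Space3} (hu : φ u < γ) (hv : γ < φ v) :
    ∃ t : ℝ, 0 < t ∧ t < 1 ∧ φ (AffineMap.lineMap u v t) = γ := by
  have : 0 < φ v - φ u := by linarith
  refine ⟨(γ - φ u) / (φ v - φ u), div_pos (by linarith) this, (div_lt_one this).2 (by linarith), ?_⟩
  rw [AffineMap.lineMap_apply_module, map_add, map_smul, map_smul, smul_eq_mul, smul_eq_mul]
  field_simp
  ring

theorem eq_of_mem_convexHull_triple {u w r x : Space3} (hu : φ u < γ) (hw : φ w < γ)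
    (hr : φ r ≤ γ) (hx : x ∈ convexHull ℝ {u, w, r}) (hxγ : φ x = γ) : x = r := by
  rw [convexHull_insert (Set.insert_nonempty _ _), convexHull_pair, mem_convexJoin] at hx
  obtain ⟨y, hy, z, hz, hx⟩ := hx
  rw [Set.mem_singleton_iff] at hy
  subst hy
  obtain ⟨a, b, ha, hb, hab, rfl⟩ := hz
  obtain ⟨c, d, hc, hd, hcd, rfl⟩ := hx
  simp only [map_add, map_smul, smul_eq_mul] at hxγ
  have h1 : c * (γ - φ y) + d * a * (γ - φ w) + d * b * (γ - φ r) = 0 := by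
    linear_combination γ * hcd + d * γ * hab - hxγ
  have p1 : 0 ≤ c * (γ - φ y) := mul_nonneg hc (by linarith)
  have p2 : 0 ≤ d * a * (γ - φ w) := mul_nonneg (mul_nonneg hd ha) (by linarith)
  have p3 : 0 ≤ d * b * (γ - φ r) := mul_nonneg (mul_nonneg hd hb) (by linarith)
  have e1 : c = 0 := by
    have : c * (γ - φ y) = 0 := by linarith
    rcases mul_eq_zero.1 this with h | h
    · exact h
    · linarith
  have e2 : d * a = 0 := by
    have : d * a * (γ - φ w) = 0 := by linarith
    rcases mul_eq_zero.1 this with h | h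
    · exact h
    · linarith
  have ed : d = 1 := by linarith
  have ea : a = 0 := by rw [ed] at e2; linarith
  have eb : b = 1 := by linarith
  simp [e1, ed, ea, eb]

/-- Outside `C`, a supporting plane of an upper facet meets `P` only across an edge of the
bottom. -/
theorem mem_range_of_notMem (h : IsCupolaIn m A B q C P φ γ) {s : Set Space3}
    (hs : IsUpperTriangle A B q s) {l : Space3 →L[ℝ] ℝ} {M : ℝ}
    (hlM : ∀ x ∈ C, (l x = M ↔ x ∈ convexHull ℝ s)) {u v : Space3} (hu : u ∈ s) (huγ : φ u < γ)
    (hv : v ∈ P) (hvC : v ∉ C) (hlv : l v = M) {w : Space3} (hw : w ∈ s) (hwu : w ≠ u) :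
    γ ≤ φ w := by
  by_contra! hwγ
  have hsC := h.cupola.upper_subset hs
  obtain ⟨r, hr, hsr⟩ : ∃ r ∈ s, s ⊆ {u, w, r} := by
    have : ∃ a b c, s = {a, b, c} := by
      rcases hs with _ | ⟨i, k, hk⟩ | ⟨i, k, hk⟩ <;> exact ⟨_, _, _, rfl⟩
    obtain ⟨a, b, c, rfl⟩ := this
    rcases hu with rfl | rfl | rfl <;> rcases hw with rfl | rfl | rfl
    all_goals first
      | exact absurd rfl hwu
      | exact ⟨a, by simp, by intro x hx; simp at hx ⊢; tauto⟩
      | exact ⟨b, by simp, by intro x hx; simp at hx ⊢; tauto⟩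
      | exact ⟨c, by simp, by intro x hx; simp at hx ⊢; tauto⟩
  have hvγ : γ < φ v := by
    by_contra! h'
    exact hvC (h.mem v hv h')
  -- The segment from `y` to `v` stays in the facet plane and crosses level `γ` inside the facet.
  -- With `u` and `w` strictly below `γ`, only `r` can be the crossing point; thus `u`, `w` and `r`
  -- all lie on lines through `v` and `r`, and are collinear.
  have key : ∀ y ∈ s, φ y < γ → ∃ t : ℝ, 0 < t ∧ t < 1 ∧ AffineMap.lineMap y v t = r := by
    intro y hy hyγ
    obtain ⟨t, ht0, ht1, ht⟩ := exists_crossing hyγ hvγ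
    refine ⟨t, ht0, ht1, ?_⟩
    have hyC := (hsC hy).1
    have hxC := h.mem _ (h.polytope.convex.lineMap_mem (h.subset hyC) hv ⟨ht0.le, ht1.le⟩) ht.le
    have hly : l y = M := (hlM y hyC).2 (subset_convexHull ℝ _ hy)
    refine eq_of_mem_convexHull_triple huγ hwγ (h.le r (hsC hr).1)
      (convexHull_mono hsr ((hlM _ hxC).1 ?_)) ht
    rw [AffineMap.lineMap_apply_module, map_add, map_smul, map_smul, hly, hlv, ← add_smul]
    simp
  obtain ⟨t, ht0, ht1, ht⟩ := key u hu huγ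
  obtain ⟨t', ht0', ht1', ht'⟩ := key w hw hwγ
  have hrγ : φ r = γ := by
    by_contra hne
    obtain ⟨τ, hτ0, hτ1, hτ⟩ := key r hr (lt_of_le_of_ne (h.le r (hsC hr).1) hne)
    have : φ (AffineMap.lineMap r v τ) = φ r := by rw [hτ]
    rw [AffineMap.lineMap_apply_module, map_add, map_smul, map_smul, smul_eq_mul,
      smul_eq_mul] at this
    have h3 := h.le r (hsC hr).1
    nlinarith
  have hru : r ≠ u := by rintro rfl; linarith
  have hrw : r ≠ w := by rintro rfl; linarith
  obtain ⟨d, hd⟩ := exists_det3_ne_zero (hsC hr) (hsC hu) (hsC hw) hru hrw hwu.symm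
  apply hd
  have e1 : (1 - t) • (u - r) = -(t • (v - r)) := by
    rw [AffineMap.lineMap_apply_module] at ht
    have : (1 - t) • (u - r) + t • (v - r) = ((1 - t) • u + t • v) - r := by module
    rw [ht, sub_self] at this
    exact eq_neg_of_add_eq_zero_left this
  have e2 : (1 - t') • (w - r) = -(t' • (v - r)) := by
    rw [AffineMap.lineMap_apply_module] at ht'
    have : (1 - t') • (w - r) + t' • (v - r) = ((1 - t') • w + t' • v) - r := by module
    rw [ht', sub_self] at this
    exact eq_neg_of_add_eq_zero_left this
  have e3 : w - r = ((1 - t) * t' / ((1 - t') * t)) • (u - r) := by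
    have h1 : (1 - t') ≠ 0 := by linarith
    have h2 : v - r = (-(1 - t) / t) • (u - r) := by
      rw [neg_div, neg_smul, div_eq_inv_mul, mul_smul, e1, smul_neg, neg_neg, smul_smul,
        inv_mul_cancel₀ ht0.ne', one_smul]
    have h3 : w - r = (-t' / (1 - t')) • (v - r) := by
      rw [neg_div, neg_smul, div_eq_inv_mul, mul_smul, ← smul_neg, ← e2, smul_smul,
        inv_mul_cancel₀ h1, one_smul]
    rw [h3, h2, smul_smul]
    congr 1
    field_simp
  rw [e3]
  simp [det3]
  ring

/-- A boundary edge of `P` at a vertex of `C` off the bottom lies in the plane of an upper facet. -/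
theorem exists_upper_of_not_interior (h : IsCupolaIn m A B q C P φ γ) {u v : Space3}
    (hu : u ∈ Set.extremePoints ℝ C) (huγ : φ u < γ) (hv : v ∈ Set.extremePoints ℝ P)
    (hint : ¬ ∃ x ∈ segment ℝ u v, x ∈ interior P) :
    ∃ s, IsUpperTriangle A B q s ∧ u ∈ s ∧ (v ∈ s ∨ v ∉ C ∧ ∀ w ∈ s, w ≠ u → γ ≤ φ w) := by
  have huP := h.subset hu.1
  have hcont : Tendsto (fun t : ℝ => φ (AffineMap.lineMap u v t)) (𝓝[>] 0) (𝓝 (φ u)) := by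
    have : Continuous fun t : ℝ => φ (AffineMap.lineMap u v t) := by fun_prop
    have h0 := this.tendsto 0
    rw [AffineMap.lineMap_apply_zero] at h0
    exact h0.mono_left nhdsWithin_le_nhds
  obtain ⟨t, ht, ht0, ht1⟩ := ((hcont.eventually (gt_mem_nhds huγ)).and
    (Ioo_mem_nhdsGT (zero_lt_one' ℝ))).exists
  set w : Space3 := AffineMap.lineMap u v t with hw
  have hwP : w ∈ P := h.polytope.convex.lineMap_mem huP hv.1 ⟨ht0.le, ht1.le⟩
  have hwC : w ∈ C := h.mem w hwP ht.le
  have hwi : w ∉ interior C := fun hwi => hint ⟨w, by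
    rw [segment_eq_image_lineMap]; exact ⟨t, ⟨ht0.le, ht1.le⟩, rfl⟩, interior_mono h.subset hwi⟩
  obtain ⟨F, hF, hwF⟩ := h.cupola.isConvexPolytope.exists_isFacet hwC hwi
  rcases h.cupola.eq_of_isFacet hF with rfl | ⟨s, hs, rfl⟩
  · exfalso
    have : convexHull ℝ (Set.range A) ⊆ {x | γ ≤ φ x} := by
      refine convexHull_min ?_ (convex_halfSpace_ge φ.toLinearMap.isLinear γ)
      rintro _ ⟨i, rfl⟩
      exact (h.bottom i).ge
    exact absurd (this hwF) (not_le.2 ht)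
  · obtain ⟨l, M, hl, hlM⟩ := h.exists_functional hs hwF ht
    have hwM := (hlM w hwC).2 hwF
    have h1 := hl u huP
    have h2 := hl v hv.1
    rw [hw, AffineMap.lineMap_apply_module, map_add, map_smul, map_smul, smul_eq_mul,
      smul_eq_mul] at hwM
    -- A functional attaining its maximum over `P` inside the segment is maximal at both ends.
    have hlu : l u = M := by nlinarith
    have hlv : l v = M := by nlinarith
    have hus : u ∈ s := mem_of_mem_extremePoints_of_mem_convexHull hu
      (h.cupola.isFacet_upper hs).subset ((hlM u hu.1).1 hlu)
    refine ⟨s, hs, hus, ?_⟩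
    by_cases hvC : v ∈ C
    · exact Or.inl (h.mem_upper_of_mem hs hv ((hlM v hvC).1 hlv))
    · exact Or.inr ⟨hvC, fun w hw hwu =>
        h.mem_range_of_notMem hs hlM hus huγ hv.1 hvC hlv hw hwu⟩

end IsCupolaIn

/-! ### Interior edges at the vertices of a cupola -/

namespace IsCupola

variable {m : ℕ} {A B : Fin 3 → Space3} {q : Fin 3 → Fin (m + 2) → Space3} {C : Set Space3}

theorem chainVertex_eq_B (hC : IsCupola m A B q C) {i p : Fin 3} {k : ℕ} (hk : k ≤ m + 1) :
    chainVertex q i k = B p ↔ i = p + 2 ∧ k = m + 1 := by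
  rw [hC.chainVertex_last, hC.chainVertex_inj hk le_rfl]

theorem chainVertex_eq_A (hC : IsCupola m A B q C) {i p : Fin 3} {k : ℕ} (hk : k ≤ m + 1) :
    chainVertex q i k = A p ↔ i = p ∧ k = 0 := by
  rw [hC.chainVertex_zero, hC.chainVertex_inj hk (by omega)]

theorem B_inj (hC : IsCupola m A B q C) {i j : Fin 3} : B i = B j ↔ i = j := by
  rw [hC.chainVertex_last, hC.chainVertex_last, hC.chainVertex_inj le_rfl le_rfl]
  simp

theorem chainVertex_mem_skylight (hC : IsCupola m A B q C) {i : Fin 3} {k : ℕ} (hk : k ≤ m + 1)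
    (h : chainVertex q i k ∈ ({B 0, B 1, B 2} : Set Space3)) : k = m + 1 := by
  rcases h with h | h | h <;> exact ((hC.chainVertex_eq_B hk).1 h).2

theorem chainVertex_mem_left (hC : IsCupola m A B q C) {i p : Fin 3} {k l : ℕ} (hk : k ≤ m + 1)
    (hl : l ≤ m)
    (h : chainVertex q i k ∈ ({B p, chainVertex q p l, chainVertex q p (l + 1)} : Set Space3)) :
    (i = p + 2 ∧ k = m + 1) ∨ (i = p ∧ (k = l ∨ k = l + 1)) := by
  rcases h with h | h | h
  · exact Or.inl ((hC.chainVertex_eq_B hk).1 h)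
  · obtain ⟨h1, h2⟩ := (hC.chainVertex_inj hk (by omega)).1 h
    exact Or.inr ⟨h1, Or.inl h2⟩
  · obtain ⟨h1, h2⟩ := (hC.chainVertex_inj hk (by omega)).1 h
    exact Or.inr ⟨h1, Or.inr h2⟩

theorem chainVertex_mem_right (hC : IsCupola m A B q C) {i p : Fin 3} {k l : ℕ} (hk : k ≤ m + 1)
    (hl : l ≤ m)
    (h : chainVertex q i k ∈
      ({A (p + 1), chainVertex q p l, chainVertex q p (l + 1)} : Set Space3)) :
    (i = p + 1 ∧ k = 0) ∨ (i = p ∧ (k = l ∨ k = l + 1)) := by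
  rcases h with h | h | h
  · exact Or.inl ((hC.chainVertex_eq_A hk).1 h)
  · obtain ⟨h1, h2⟩ := (hC.chainVertex_inj hk (by omega)).1 h
    exact Or.inr ⟨h1, Or.inl h2⟩
  · obtain ⟨h1, h2⟩ := (hC.chainVertex_inj hk (by omega)).1 h
    exact Or.inr ⟨h1, Or.inr h2⟩

end IsCupola

theorem Fin.add_two_ne_self (p : Fin 3) : p + 2 ≠ p := by revert p; decide

theorem Fin.add_one_ne_self' (p : Fin 3) : p + 1 ≠ p := by revert p; decide

namespace IsCupolaIn

variable {m : ℕ} {A B : Fin 3 → Space3} {q : Fin 3 → Fin (m + 2) → Space3} {C P : Set Space3}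
  {φ : Space3 →L[ℝ] ℝ} {γ : ℝ}

/-- Nonadjacent vertices of a chain span an interior edge. -/
theorem interior_chain_chain (h : IsCupolaIn m A B q C P φ γ) (i : Fin 3) {a b : ℕ}
    (hab : a + 2 ≤ b) (hb : b ≤ m + 1) (ha : chainVertex q i a ∈ Set.extremePoints ℝ P) :
    ∃ x ∈ segment ℝ (chainVertex q i b) (chainVertex q i a), x ∈ interior P := by
  by_contra hint
  have hC := h.cupola
  obtain ⟨s, hs, hus, hvs | ⟨hvC, -⟩⟩ := h.exists_upper_of_not_interior (hC.chainVertex_mem i b)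
    (h.chainVertex_lt i (by omega) hb) ha hint
  · rcases hs with _ | ⟨p, l, hl⟩ | ⟨p, l, hl⟩
    · have := hC.chainVertex_mem_skylight hb hus
      have := hC.chainVertex_mem_skylight (by omega) hvs
      omega
    · have h1 := hC.chainVertex_mem_left hb hl hus
      have h2 := hC.chainVertex_mem_left (by omega) hl hvs
      have := Fin.add_two_ne_self p
      rcases h1 with ⟨rfl, h1⟩ | ⟨rfl, h1⟩ <;> rcases h2 with ⟨h2, h3⟩ | ⟨h2, h3⟩
      · omega
      · exact this h2
      · exact this h2.symm
      · omega
    · have h1 := hC.chainVertex_mem_right hb hl hus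
      have h2 := hC.chainVertex_mem_right (by omega) hl hvs
      have := Fin.add_one_ne_self' p
      rcases h1 with ⟨rfl, h1⟩ | ⟨rfl, h1⟩ <;> rcases h2 with ⟨h2, h3⟩ | ⟨h2, h3⟩
      · omega
      · exact this h2
      · exact this h2.symm
      · omega
  · exact hvC (hC.chainVertex_mem i a).1

/-- An edge from an inner chain vertex to a vertex which is not one of its neighbours is interior,
except possibly for one that runs in the boundary across the bottom. -/
theorem interior_chain_of_ne (h : IsCupolaIn m A B q C P φ γ) (i : Fin 3) {k : ℕ} (hk : k ≠ 0)
    (hkm : k ≤ m) {y : Space3} (hy : y ∈ Set.extremePoints ℝ P) (hyB : y ≠ B i)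
    (hyA : y ≠ A (i + 1)) (hyc : ∀ j ≤ m + 1, y ≠ chainVertex q i j) :
    (∃ x ∈ segment ℝ (chainVertex q i k) y, x ∈ interior P) ∨ (y ∉ C ∧ k = 1) := by
  by_contra! hcon
  obtain ⟨hint, hk1⟩ := hcon
  have hC := h.cupola
  obtain ⟨s, hs, hus, hvs⟩ := h.exists_upper_of_not_interior (hC.chainVertex_mem i k)
    (h.chainVertex_lt i hk (by omega)) hy (by push Not; exact hint)
  rcases hs with _ | ⟨p, l, hl⟩ | ⟨p, l, hl⟩
  · have := hC.chainVertex_mem_skylight (by omega) hus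
    omega
  · have h1 := hC.chainVertex_mem_left (by omega) hl hus
    rcases h1 with ⟨rfl, h1⟩ | ⟨rfl, h1⟩
    · omega
    rcases hvs with hvs | ⟨hyC, hvs⟩
    · rcases hvs with hvs | hvs | hvs
      · exact hyB hvs
      · exact hyc _ (by omega) hvs
      · exact hyc _ (by omega) hvs
    · have := hvs (B i) (by simp) (by
        intro he
        have := (hC.chainVertex_eq_B (by omega)).1 he.symm
        omega)
      exact absurd this (not_le.2 (h.B_lt i))
  · have h1 := hC.chainVertex_mem_right (by omega) hl hus
    rcases h1 with ⟨rfl, h1⟩ | ⟨rfl, h1⟩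
    · omega
    rcases hvs with hvs | ⟨hyC, hvs⟩
    · rcases hvs with hvs | hvs | hvs
      · exact hyA hvs
      · exact hyc _ (by omega) hvs
      · exact hyc _ (by omega) hvs
    -- A right facet can extend beyond `C` only if its other two vertices are on the bottom, which
    -- needs `k = 1`. For `k ≠ 1` it has a second chain vertex of positive index.
    · have hk2 := hk1 hyC
      have : ∃ j, j ≠ 0 ∧ j ≠ k ∧ (j = l ∨ j = l + 1) := by
        rcases h1 with h1 | h1
        · exact ⟨l + 1, by omega, by omega, Or.inr rfl⟩
        · exact ⟨l, by omega, by omega, Or.inl rfl⟩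
      obtain ⟨j, hj0, hjk, hj⟩ := this
      have hmem : chainVertex q i j ∈
          ({A (i + 1), chainVertex q i l, chainVertex q i (l + 1)} : Set Space3) := by
        rcases hj with rfl | rfl <;> simp
      have := hvs _ hmem (by
        intro he
        exact hjk ((hC.chainVertex_inj (by omega) (by omega)).1 he).2)
      exact absurd this (not_le.2 (h.chainVertex_lt i hj0 (by omega)))

/-- An edge from a vertex of the skylight to a vertex outside of the cupola is interior. -/
theorem interior_B_of_notMem (h : IsCupolaIn m A B q C P φ γ) (hm : m ≠ 0) (i : Fin 3)
    {y : Space3} (hy : y ∈ Set.extremePoints ℝ P) (hyC : y ∉ C) :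
    ∃ x ∈ segment ℝ (B i) y, x ∈ interior P := by
  by_contra hint
  have hC := h.cupola
  obtain ⟨s, hs, hus, hvs⟩ := h.exists_upper_of_not_interior (hC.B_mem i) (h.B_lt i) hy hint
  rcases hvs with hvs | ⟨-, hvs⟩
  · exact hyC (hC.upper_subset hs hvs).1
  have key : ∃ w ∈ s, w ≠ B i ∧ φ w < γ := by
    rcases hs with _ | ⟨p, l, hl⟩ | ⟨p, l, hl⟩
    · by_cases hi : i = 0
      · exact ⟨B 1, by simp, by rw [Ne, hC.B_inj, hi]; decide, h.B_lt 1⟩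
      · exact ⟨B 0, by simp, by rw [Ne, hC.B_inj]; exact Ne.symm hi, h.B_lt 0⟩
    · by_cases hi : i = p
      · refine ⟨chainVertex q p (l + 1), by simp, ?_, h.chainVertex_lt p (by omega) (by omega)⟩
        rw [Ne, hC.chainVertex_eq_B (by omega), hi]
        exact fun h' => Fin.add_two_ne_self p h'.1.symm
      · exact ⟨B p, by simp, by rw [Ne, hC.B_inj]; exact Ne.symm hi, h.B_lt p⟩
    · rw [hC.chainVertex_last] at hus
      have h1 := hC.chainVertex_mem_right le_rfl hl hus
      -- A right facet through `B i` contains the last edge of its chain; as `m ≠ 0`, the preceding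
      -- chain vertex is off the bottom.
      have : l = m := by omega
      refine ⟨chainVertex q p l, by simp, ?_, h.chainVertex_lt p (by omega) (by omega)⟩
      rw [Ne, hC.chainVertex_eq_B (by omega)]
      omega
  obtain ⟨w, hw, hwB, hwγ⟩ := key
  exact absurd (hvs w hw hwB) (not_le.2 hwγ)

/-- The edges of `C` joining `B i` to the inner vertices of the `i`-th chain are edges of `P`. -/
theorem edge_B_chain (h : IsCupolaIn m A B q C P φ γ) (i : Fin 3) {k : ℕ} (hk : k ≠ 0)
    (hkm : k ≤ m) {t : Finset Space3} (ht : (t : Set Space3) ⊆ Set.extremePoints ℝ P)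
    (hmid : midpoint ℝ (B i) (chainVertex q i k) ∈ convexHull ℝ (t : Set Space3)) :
    B i ∈ t ∧ chainVertex q i k ∈ t := by
  classical
  have hC := h.cupola
  obtain ⟨k, rfl⟩ := Nat.exists_eq_succ_of_ne_zero hk
  simp only [Nat.succ_eq_add_one] at *
  have hs1 : IsUpperTriangle A B q _ := .left i k (by omega)
  have hs2 : IsUpperTriangle A B q _ := .left i (k + 1) hkm
  have hB1 := subset_convexHull ℝ _ (Set.mem_insert (B i) {chainVertex q i k, chainVertex q i (k + 1)})
  have hB2 := subset_convexHull ℝ _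
    (Set.mem_insert (B i) {chainVertex q i (k + 1), chainVertex q i (k + 1 + 1)})
  obtain ⟨l1, M1, hl1, hlM1⟩ := h.exists_functional hs1 hB1 (h.B_lt i)
  obtain ⟨l2, M2, hl2, hlM2⟩ := h.exists_functional hs2 hB2 (h.B_lt i)
  have hBC := (hC.B_mem i).1
  have hcC := (hC.chainVertex_mem i (k + 1)).1
  have e1 : l1 (B i) = M1 := (hlM1 _ hBC).2 hB1
  have e2 : l2 (B i) = M2 := (hlM2 _ hBC).2 hB2
  have e3 : l1 (chainVertex q i (k + 1)) = M1 :=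
    (hlM1 _ hcC).2 (subset_convexHull ℝ _ (by simp))
  have e4 : l2 (chainVertex q i (k + 1)) = M2 :=
    (hlM2 _ hcC).2 (subset_convexHull ℝ _ (by simp))
  have hne : B i ≠ chainVertex q i (k + 1) := fun he => by
    have := (hC.chainVertex_eq_B (by omega)).1 he.symm
    omega
  have hface : ∀ v ∈ Set.extremePoints ℝ P, l1 v = M1 → l2 v = M2 →
      v = B i ∨ v = chainVertex q i (k + 1) := by
    intro v hv h1 h2
    by_cases hvC : v ∈ C
    · have m1 := h.mem_upper_of_mem hs1 hv ((hlM1 v hvC).1 h1)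
      have m2 := h.mem_upper_of_mem hs2 hv ((hlM2 v hvC).1 h2)
      rcases m1 with m1 | m1 | m1
      · exact Or.inl m1
      · rcases m2 with m2 | m2 | m2
        · exact Or.inl m2
        · exact Or.inr m2
        · rw [m1, Set.mem_singleton_iff, hC.chainVertex_inj (by omega) (by omega)] at m2
          omega
      · exact Or.inr m1
    · exfalso
      have hvγ : γ < φ v := by
        by_contra! h'
        exact hvC (h.mem v hv.1 h')
      -- The second facet is used because all its vertices are strictly below `γ`, so it contains no
      -- crossing point; the first one touches the bottom when `k = 0`.
      obtain ⟨τ, h0, h1', hτ⟩ := exists_crossing (h.B_lt i) hvγ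
      have hxC := h.mem _ (h.polytope.convex.lineMap_mem (h.subset hBC) hv.1 ⟨h0.le, h1'.le⟩) hτ.le
      have hx2 := (hlM2 _ hxC).1 (by
        rw [AffineMap.lineMap_apply_module, map_add, map_smul, map_smul, e2, h2, ← add_smul]
        simp)
      have : convexHull ℝ ({B i, chainVertex q i (k + 1), chainVertex q i (k + 1 + 1)} : Set Space3)
          ⊆ {x | φ x < γ} := by
        refine convexHull_min ?_ (convex_halfSpace_lt φ.toLinearMap.isLinear γ)
        rintro x (rfl | rfl | rfl)
        · exact h.B_lt i
        · exact h.chainVertex_lt i (by omega) (by omega)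
        · exact h.chainVertex_lt i (by omega) (by omega)
      exact (this hx2).ne hτ
  rw [Finset.convexHull_eq] at hmid
  obtain ⟨w, hw0, hw1, hwx⟩ := hmid
  rw [Finset.centerMass_eq_of_sum_1 _ _ hw1] at hwx
  -- The functional `l1 + l2` is maximal at the midpoint, so only vertices common to both facets
  -- carry weight, and the midpoint needs both ends of the edge.
  have hL := congrArg (l1 + l2) hwx
  have hLmid : (l1 + l2) (midpoint ℝ (B i) (chainVertex q i (k + 1))) = M1 + M2 := by
    rw [midpoint_eq_smul_add, map_smul, map_add]
    change _ • ((l1 _ + l2 _) + (l1 _ + l2 _)) = _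
    rw [e1, e2, e3, e4, invOf_eq_inv, smul_eq_mul]
    ring
  rw [hLmid, map_sum] at hL
  have hle : ∀ v ∈ t, (l1 + l2) v ≤ M1 + M2 := fun v hv =>
    add_le_add (hl1 v (ht hv).1) (hl2 v (ht hv).1)
  have hzero : ∀ v ∈ t, w v * (M1 + M2 - (l1 + l2) v) = 0 := by
    refine (Finset.sum_eq_zero_iff_of_nonneg fun v hv => ?_).1 ?_
    · exact mul_nonneg (hw0 v hv) (sub_nonneg.2 (hle v hv))
    · simp only [mul_sub, Finset.sum_sub_distrib, ← Finset.sum_mul, hw1]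
      rw [sub_eq_zero, one_mul, ← hL]
      refine Finset.sum_congr rfl fun v _ => ?_
      simp
  have hwz : ∀ v ∈ t, v ≠ B i → v ≠ chainVertex q i (k + 1) → w v = 0 := by
    intro v hv n1 n2
    rcases mul_eq_zero.1 (hzero v hv) with h' | h'
    · exact h'
    · exfalso
      have a1 := hl1 v (ht hv).1
      have a2 := hl2 v (ht hv).1
      have a3 : (l1 + l2) v = l1 v + l2 v := rfl
      rcases hface v (ht hv) (by linarith) (by linarith) with h'' | h''
      · exact n1 h''
      · exact n2 h''
  have hsingle : ∀ u : Space3, (∀ v ∈ t, v ≠ u → w v = 0) →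
      midpoint ℝ (B i) (chainVertex q i (k + 1)) = u := by
    intro u hu
    by_cases hut : u ∈ t
    · rw [Finset.sum_eq_single_of_mem u hut hu] at hw1
      rw [Finset.sum_eq_single_of_mem u hut (fun v hv hvu => by rw [hu v hv hvu, zero_smul]), hw1,
        one_smul] at hwx
      exact hwx.symm
    · rw [Finset.sum_eq_zero (fun v hv => hu v hv (fun h' => hut (h' ▸ hv)))] at hw1
      exact absurd hw1 zero_ne_one
  constructor
  · by_contra hB
    have := hsingle (chainVertex q i (k + 1)) fun v hv hvu => hwz v hv (fun h' => hB (h' ▸ hv)) hvu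
    exact hne ((midpoint_eq_right_iff ℝ).1 this)
  · by_contra hB
    have := hsingle (B i) fun v hv hvu => hwz v hv hvu (fun h' => hB (h' ▸ hv))
    exact hne ((midpoint_eq_left_iff ℝ).1 this)

end IsCupolaIn

/-! ### Sides of planes and the missing diagonal -/

theorem mem_convexHull_four (o a b c : Space3) {r s t : ℝ} (hr : 0 ≤ r) (hs : 0 ≤ s) (ht : 0 ≤ t)
    (h : r + s + t ≤ 1) :
    o + r • (a - o) + s • (b - o) + t • (c - o) ∈ convexHull ℝ ({o, a, b, c} : Set Space3) := by
  have hc := convex_convexHull ℝ ({o, a, b, c} : Set Space3)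
  have hsum := hc.sum_mem (t := Finset.univ) (w := ![1 - r - s - t, r, s, t]) (z := ![o, a, b, c])
    (by intro i _; fin_cases i <;> simp <;> linarith) (by simp [Fin.sum_univ_four]; ring)
    (by intro i _; fin_cases i <;> exact subset_convexHull ℝ _ (by simp))
  convert hsum using 1
  simp [Fin.sum_univ_four]
  module

theorem exists_coords {x y z : Space3} (h : det3 x y z ≠ 0) (w : Space3) :
    ∃ a b c : ℝ, w = a • x + b • y + c • z ∧ b = det3 x w z / det3 x y z := by
  refine ⟨det3 w y z / det3 x y z, _, det3 x y w / det3 x y z, ?_, rfl⟩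
  have := congrArg (fun v => (det3 x y z)⁻¹ • v) (det3_cramer x y z w)
  simp only [smul_add, smul_smul, inv_mul_cancel₀ h, one_smul] at this
  simpa only [div_eq_inv_mul] using this

theorem add_smul_mem_affineSpan (a b c : Space3) (r s : ℝ) :
    a + r • (b - a) + s • (c - a) ∈ affineSpan ℝ ({a, b, c} : Set Space3) := by
  have ha : a ∈ affineSpan ℝ ({a, b, c} : Set Space3) := mem_affineSpan ℝ (by simp)
  have hb : b ∈ affineSpan ℝ ({a, b, c} : Set Space3) := mem_affineSpan ℝ (by simp)
  have hc : c ∈ affineSpan ℝ ({a, b, c} : Set Space3) := mem_affineSpan ℝ (by simp)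
  have h1 := AffineSubspace.vadd_mem_of_mem_direction
    (add_mem (Submodule.smul_mem _ r (AffineSubspace.vsub_mem_direction hb ha))
      (Submodule.smul_mem _ s (AffineSubspace.vsub_mem_direction hc ha))) ha
  convert h1 using 1
  simp only [vsub_eq_sub, vadd_eq_add]
  abel

theorem wSameSide_of_coords {a b c x y e : Space3} {r s β r' s' β' : ℝ}
    (hx : x - a = r • (b - a) + β • e + s • (c - a))
    (hy : y - a = r' • (b - a) + β' • e + s' • (c - a)) (h : 0 ≤ β * β') :
    (affineSpan ℝ ({a, b, c} : Set Space3)).WSameSide x y := by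
  refine ⟨_, add_smul_mem_affineSpan a b c r s, _, add_smul_mem_affineSpan a b c r' s', ?_⟩
  have e1 : x -ᵥ (a + r • (b - a) + s • (c - a)) = β • e := by
    rw [vsub_eq_sub, sub_eq_iff_eq_add.1 hx]; abel
  have e2 : y -ᵥ (a + r' • (b - a) + s' • (c - a)) = β' • e := by
    rw [vsub_eq_sub, sub_eq_iff_eq_add.1 hy]; abel
  rw [e1, e2]
  rcases mul_nonneg_iff.1 h with ⟨h1, h2⟩ | ⟨h1, h2⟩
  · exact ((SameRay.refl (R := ℝ) e).nonneg_smul_left h1).nonneg_smul_right h2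
  · have := ((SameRay.refl (R := ℝ) (-e)).nonneg_smul_left (neg_nonneg.2 h1)).nonneg_smul_right
      (neg_nonneg.2 h2)
    simpa using this

theorem mem_affineSpan_of_det3_eq_zero {a b c y : Space3} (hw : ∃ w, det3 (b - a) (c - a) w ≠ 0)
    (hy : det3 (b - a) (c - a) (y - a) = 0) : y ∈ affineSpan ℝ ({a, b, c} : Set Space3) := by
  obtain ⟨w, hw⟩ := hw
  have := congrArg (fun v => (det3 (b - a) (c - a) w)⁻¹ • v) (det3_cramer (b - a) (c - a) w (y - a))
  simp only [smul_add, smul_smul, inv_mul_cancel₀ hw, one_smul, hy, zero_smul,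
    add_zero] at this
  rw [sub_eq_iff_eq_add.1 this, add_comm, ← add_assoc]
  exact add_smul_mem_affineSpan _ _ _ _ _

theorem functional_eq_zero_of_mem_affineSpan {a b c y : Space3} {L : Space3 →L[ℝ] ℝ}
    (hb : L (b - a) = 0) (hc : L (c - a) = 0)
    (hy : y ∈ affineSpan ℝ ({a, b, c} : Set Space3)) : L (y - a) = 0 := by
  have : affineSpan ℝ ({a, b, c} : Set Space3) ≤
      AffineSubspace.mk' a (LinearMap.ker (L : Space3 →ₗ[ℝ] ℝ)) := by
    rw [affineSpan_le]
    rintro z (rfl | rfl | rfl)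
    · exact AffineSubspace.self_mem_mk' _ _
    · rw [SetLike.mem_coe, AffineSubspace.mem_mk']; simpa using hb
    · rw [SetLike.mem_coe, AffineSubspace.mem_mk']; simpa using hc
  have h := this hy
  rw [AffineSubspace.mem_mk'] at h
  exact h

theorem sOppSide_functional {a b c x y : Space3} (hw : ∃ w, det3 (b - a) (c - a) w ≠ 0)
    (h : (affineSpan ℝ ({a, b, c} : Set Space3)).SOppSide x y) :
    ∃ L : Space3 →L[ℝ] ℝ, L (b - a) = 0 ∧ L (c - a) = 0 ∧ L (x - a) = 1 ∧ L (y - a) < 0 := by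
  obtain ⟨⟨p, hp, q, hq, hray⟩, hx, hy⟩ := h
  have hx0 : det3 (b - a) (c - a) (x - a) ≠ 0 := fun h0 =>
    hx (mem_affineSpan_of_det3_eq_zero hw h0)
  have hy0 : det3 (b - a) (c - a) (y - a) ≠ 0 := fun h0 =>
    hy (mem_affineSpan_of_det3_eq_zero hw h0)
  let D := det3L (b - a) (c - a)
  have hDb : D (b - a) = 0 := det3_self_left _ _
  have hDc : D (c - a) = 0 := det3_self_right _ _
  have hDp := functional_eq_zero_of_mem_affineSpan hDb hDc hp
  have hDq := functional_eq_zero_of_mem_affineSpan hDb hDc hq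
  have hDx : D (x - a) ≠ 0 := hx0
  have hDy : D (y - a) ≠ 0 := hy0
  refine ⟨(D (x - a))⁻¹ • D, by simp [hDb], by simp [hDc], inv_mul_cancel₀ hDx, ?_⟩
  change (D (x - a))⁻¹ * D (y - a) < 0
  have hxp : x -ᵥ p ≠ 0 := by
    rw [vsub_eq_sub, sub_ne_zero]; rintro rfl; exact hx hp
  have hqy : q -ᵥ y ≠ 0 := by
    rw [vsub_eq_sub, sub_ne_zero]; rintro rfl; exact hy hq
  obtain ⟨r1, r2, hr1, hr2, hr⟩ := hray.exists_pos hxp hqy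
  have e1 : D (x -ᵥ p) = D (x - a) := by
    rw [vsub_eq_sub, show x - p = (x - a) - (p - a) by abel, map_sub, hDp, sub_zero]
  have e2 : D (q -ᵥ y) = -D (y - a) := by
    rw [vsub_eq_sub, show q - y = (q - a) - (y - a) by abel, map_sub, hDq, zero_sub]
  have h3 := congrArg D hr
  rw [map_smul, map_smul, e1, e2, smul_eq_mul, smul_eq_mul] at h3
  have h4 : D (y - a) = -(r1 / r2) * D (x - a) := by
    field_simp; linarith
  rw [h4, mul_comm, mul_assoc, mul_inv_cancel₀ hDx, mul_one, neg_lt_zero]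
  exact div_pos hr1 hr2

/-- For `r < 0` the point lies beyond `v` on the ray from `u`, so `v` would be strictly between two
points of `P`. This confines intersection points on the line of an edge to the edge itself. -/
theorem eq_of_smul_add_smul_mem {P : Set Space3} {u v : Space3} {r r' : ℝ} (hrr : r + r' = 1)
    (hr : r < 0) (hv : v ∈ Set.extremePoints ℝ P) (hu : u ∈ P) (hpt : r • u + r' • v ∈ P) :
    r • u + r' • v = v := by
  have hr' : 0 < r' := by linarith
  refine hv.2 hpt hu ⟨1 / r', -r / r', by positivity, div_pos (by linarith) hr', ?_, ?_⟩
  · rw [← add_div, div_eq_one_iff_eq hr'.ne']; linarith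
  · match_scalars <;> field_simp <;> ring

/-- A triangle of a triangulation is not pierced by a disjoint edge. -/
theorem IsTriangulation.false_of_pierce {P : Set Space3} {T : Finset (Finset Space3)}
    (hT : IsTriangulation P T) {t t' : Finset Space3} (ht : t ∈ T) (ht' : t' ∈ T)
    {x y z u v : Space3} (hx : x ∈ t) (hy : y ∈ t) (hz : z ∈ t) (hu : u ∈ t') (hv : v ∈ t')
    (hxu : x ≠ u) (hxv : x ≠ v) (hyu : y ≠ u) (hyv : y ≠ v) (hzu : z ≠ u) (hzv : z ≠ v)
    {r r' s s' : ℝ} (hrr : r + r' = 1) (hs : 0 ≤ s) (hs' : 0 ≤ s') (hss : s + s' ≤ 1)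
    (hpt : r • u + r' • v = y + s • (x - y) + s' • (z - y)) : False := by
  classical
  set pt := r • u + r' • v with hptdef
  have hF : ({x, y, z} : Finset Space3) ∈ triangulationFaces T := by
    refine mem_triangulationFaces.2 ⟨⟨x, by simp⟩, t, ht, ?_⟩
    simp [Finset.insert_subset_iff, hx, hy, hz]
  have hG : ({u, v} : Finset Space3) ∈ triangulationFaces T := by
    refine mem_triangulationFaces.2 ⟨⟨u, by simp⟩, t', ht', ?_⟩
    simp [Finset.insert_subset_iff, hu, hv]
  have hptF : pt ∈ convexHull ℝ (({x, y, z} : Finset Space3) : Set Space3) := by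
    rw [hpt]
    have h4 := mem_convexHull_four y x z z hs hs' le_rfl (by linarith)
    rw [zero_smul, add_zero] at h4
    refine convexHull_mono ?_ h4
    intro w hw
    simp at hw ⊢
    tauto
  have hptP : pt ∈ P := hT.convexHull_subset hF hptF
  have hne : ∀ w ∈ ({x, y, z} : Finset Space3), w ≠ u ∧ w ≠ v := by
    intro w hw
    simp only [Finset.mem_insert, Finset.mem_singleton] at hw
    rcases hw with rfl | rfl | rfl
    · exact ⟨hxu, hxv⟩
    · exact ⟨hyu, hyv⟩
    · exact ⟨hzu, hzv⟩
  have hue := hT.vertices t' ht' hu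
  have hve := hT.vertices t' ht' hv
  -- An end of the edge is a vertex of `P`; lying in the triangle, it would be one of `x`, `y`, `z`.
  have hptne : pt ≠ u ∧ pt ≠ v := by
    by_cases hpe : pt ∈ Set.extremePoints ℝ P
    · exact hne pt (mem_of_mem_extremePoints_of_mem_convexHull hpe (hT.convexHull_subset hF) hptF)
    · exact ⟨fun he => hpe (he ▸ hue), fun he => hpe (he ▸ hve)⟩
  have hr0 : 0 ≤ r := by
    by_contra! hneg
    exact hptne.2 (eq_of_smul_add_smul_mem hrr hneg hve hue.1 hptP)
  have hr0' : 0 ≤ r' := by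
    by_contra! hneg
    rw [hptdef, add_comm] at hptP hptne
    exact hptne.1 (eq_of_smul_add_smul_mem (by linarith) hneg hue hve.1 hptP)
  have hptG : pt ∈ convexHull ℝ (({u, v} : Finset Space3) : Set Space3) := by
    rw [Finset.coe_pair, convexHull_pair]
    exact ⟨r, r', hr0, hr0', hrr, rfl⟩
  have hmem := hT.faces_inter hF hG ⟨hptF, hptG⟩
  obtain ⟨w, hw⟩ := convexHull_nonempty_iff.1 ⟨pt, hmem⟩
  rw [Finset.mem_coe, Finset.mem_inter] at hw
  have h1 := hne w hw.1
  have h2 := hw.2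
  simp only [Finset.mem_insert, Finset.mem_singleton] at h2
  tauto

/-- If `x` and `z` lie on opposite sides of the plane of `y, u, v`, and `x` and `y` on opposite
sides of the plane of `z, u, v`, then the triangle `x, y, z` meets the line `u, v`. -/
theorem exists_pierce {x y z u v e : Space3} {a b c a' b' c' : ℝ} {L : Space3 →L[ℝ] ℝ}
    (hx : x - y = a • (u - y) + b • e + c • (v - y))
    (hz : z - y = a' • (u - y) + b' • e + c' • (v - y))
    (hLy : L (y - u) = 1) (hLu : L (u - y) = -1) (hLv : L (v - y) = -1) (hLz : L (z - u) = 0)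
    (hLx : L (x - u) < 0) (hb : 0 < b) (hb' : b' < 0) :
    ∃ r r' s s' : ℝ, r + r' = 1 ∧ 0 ≤ s ∧ 0 ≤ s' ∧ s + s' ≤ 1 ∧
      r • u + r' • v = y + s • (x - y) + s' • (z - y) := by
  -- With this weight `(x - y) + g • (z - y)` loses its component along `e` and lies in the plane of
  -- `y`, `u`, `v`. Dividing by `S`, the sum of its two coordinates there, scales it onto the line
  -- through `u` and `v`; `S ≥ 1 + g` since `L (x - u) < 0`.
  set g := b / -b' with hg
  have hgb : g * b' = -b := by rw [hg, div_neg, neg_mul, div_mul_cancel₀ _ hb'.ne]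
  have hgpos : 0 < g := div_pos hb (by linarith)
  set S : ℝ := 1 + -L (x - u) + g with hS
  have hSpos : 0 < S := by linarith
  have h1 : L (x - u) = 1 - a - c + b * L e := by
    rw [show x - u = (x - y) + (y - u) by abel, map_add, hLy, hx]
    simp only [map_add, map_smul, smul_eq_mul, hLu, hLv]
    ring
  have h2 : 1 - a' - c' + b' * L e = 0 := by
    rw [← hLz, show z - u = (z - y) + (y - u) by abel, map_add, hLy, hz]
    simp only [map_add, map_smul, smul_eq_mul, hLu, hLv]
    ring
  have hsum : (a + g * a') + (c + g * c') = S := by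
    rw [hS, h1]
    linear_combination (-g) * h2 + hgb * L e
  refine ⟨(a + g * a') / S, (c + g * c') / S, 1 / S, g / S, ?_, by positivity, by positivity, ?_,
    ?_⟩
  · rw [← add_div, hsum, div_self hSpos.ne']
  · rw [← add_div, div_le_one hSpos]; linarith
  · have key : S • (((a + g * a') / S) • u + ((c + g * c') / S) • v) =
        S • (y + (1 / S) • (x - y) + (g / S) • (z - y)) := by
      have e1 : S • (((a + g * a') / S) • u + ((c + g * c') / S) • v) =
          S • y + ((a + g * a') • (u - y) + (c + g * c') • (v - y)) := by
        rw [← hsum]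
        rw [smul_add, smul_smul, smul_smul, hsum, mul_div_cancel₀ _ hSpos.ne',
          mul_div_cancel₀ _ hSpos.ne', ← hsum]
        module
      have e2 : S • (y + (1 / S) • (x - y) + (g / S) • (z - y)) =
          S • y + ((x - y) + g • (z - y)) := by
        rw [smul_add, smul_add, smul_smul, smul_smul, mul_div_cancel₀ _ hSpos.ne',
          mul_div_cancel₀ _ hSpos.ne', one_smul, add_assoc]
      have e3 : (b + g * b') • e = 0 := by rw [hgb, add_neg_cancel, zero_smul]
      rw [e1, e2, hx, hz, add_right_inj, ← sub_eq_zero, ← neg_eq_zero, ← e3]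
      module
    exact smul_right_injective Space3 hSpos.ne' key

namespace IsCupolaIn

variable {m : ℕ} {A B : Fin 3 → Space3} {q : Fin 3 → Fin (m + 2) → Space3} {C P : Set Space3}
  {φ : Space3 →L[ℝ] ℝ} {γ : ℝ} {T : Finset (Finset Space3)}

/-- Upper facets yield functionals which vanish exactly on the vertices of the facet. -/
theorem exists_functional_at (h : IsCupolaIn m A B q C P φ γ) {s : Set Space3}
    (hs : IsUpperTriangle A B q s) {f : Space3} (hf : f ∈ s) (hfγ : φ f < γ) :
    ∃ l : Space3 →L[ℝ] ℝ, (∀ x ∈ P, l (x - f) ≤ 0) ∧ (∀ x ∈ s, l (x - f) = 0) ∧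
      ∀ x ∈ Set.extremePoints ℝ C, x ∉ s → l (x - f) < 0 := by
  have hfs := subset_convexHull ℝ s hf
  obtain ⟨l, M, hl, hlM⟩ := h.exists_functional hs hfs hfγ
  have hsC := h.cupola.upper_subset hs
  have hM : ∀ x ∈ s, l x = M := fun x hx => (hlM x (hsC hx).1).2 (subset_convexHull ℝ s hx)
  refine ⟨l, fun x hx => ?_, fun x hx => ?_, fun x hx hxs => ?_⟩
  · rw [map_sub, hM f hf]; linarith [hl x hx]
  · rw [map_sub, hM f hf, hM x hx, sub_self]
  · rw [map_sub, hM f hf, sub_neg]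
    refine lt_of_le_of_ne (hl x (h.subset hx.1)) fun he => hxs ?_
    exact mem_of_mem_extremePoints_of_mem_convexHull hx (h.cupola.isFacet_upper hs).subset
      ((hlM x hx.1).1 he)

/-- If the tetrahedron at the skylight leaves the visibility cone through the `i`-th plane, then
it pierces the diagonal from `B i` to `A (i + 1)`. -/
theorem not_diagonal (h : IsCupolaIn m A B q C P φ γ) (hm : m ≠ 0) (hT : IsTriangulation P T)
    {t : Finset Space3} (ht : t ∈ T) (htB : ∀ i, B i ∈ t) {x : Space3} (hxt : x ∈ t)
    (hxB : x ∉ Set.range B) {i : Fin 3}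
    (hx : ¬ (affineSpan ℝ {B i, B (i + 1), A (i + 1)}).WSameSide (B (i + 2)) x) :
    ∀ t' ∈ T, B i ∈ t' → A (i + 1) ∉ t' := by
  classical
  intro t' ht' hBt' hAt'
  have hC := h.cupola
  have hxP := hT.vertices t ht hxt
  have hpm := hC.chainVertex_mem i m
  have hlast : chainVertex q i (m + 1) = B (i + 1) := by
    rw [hC.chainVertex_eq_B le_rfl]
    exact ⟨by clear * -; revert i; decide, rfl⟩
  have hne10 : B (i + 1) ≠ B i := by rw [Ne, hC.B_inj]; exact Fin.add_one_ne_self' i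
  have hne20 : B (i + 2) ≠ B i := by rw [Ne, hC.B_inj]; exact Fin.add_two_ne_self i
  have hAγ := h.bottom (i + 1)
  have hAB : ∀ j, A (i + 1) ≠ B j := fun j he => by
    have := h.B_lt j
    rw [← he] at this; linarith
  have hpγ := h.chainVertex_lt i hm (by omega)
  have hAp : A (i + 1) ≠ chainVertex q i m := fun he => by rw [← he] at hpγ; linarith
  have hpB : ∀ j, chainVertex q i m ≠ B j := fun j he => by
    rw [hC.chainVertex_eq_B (by omega)] at he; omega
  have hs1 : IsUpperTriangle A B q {B i, chainVertex q i m, B (i + 1)} := by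
    rw [← hlast]; exact .left i m le_rfl
  have hs2 : IsUpperTriangle A B q {A (i + 1), chainVertex q i m, B (i + 1)} := by
    rw [← hlast]; exact .right i m le_rfl
  have hs3 : IsUpperTriangle A B q {B i, B (i + 1), B (i + 2)} := by
    have : ({B i, B (i + 1), B (i + 2)} : Set Space3) = {B 0, B 1, B 2} := by
      fin_cases i
      · rfl
      · ext y; simp [show (1 : Fin 3) + 1 = 2 from rfl, show (1 : Fin 3) + 2 = 0 from rfl]; tauto
      · ext y; simp [show (2 : Fin 3) + 1 = 0 from rfl, show (2 : Fin 3) + 2 = 1 from rfl]; tauto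
    rw [this]; exact .skylight
  have hB1γ := h.B_lt (i + 1)
  obtain ⟨l1, hl1P, hl1s, hl1⟩ := h.exists_functional_at hs1 (f := B (i + 1)) (by simp) hB1γ
  obtain ⟨l2, hl2P, hl2s, hl2⟩ := h.exists_functional_at hs2 (f := B (i + 1)) (by simp) hB1γ
  obtain ⟨l3, hl3P, hl3s, hl3⟩ := h.exists_functional_at hs3 (f := B (i + 1)) (by simp) hB1γ
  have hBP : B (i + 2) ∈ P := h.subset (hC.B_mem _).1
  have a10 : l1 (B i - B (i + 1)) = 0 := hl1s _ (by simp)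
  have a11 : l1 (chainVertex q i m - B (i + 1)) = 0 := hl1s _ (by simp)
  have a12 : l1 (A (i + 1) - B (i + 1)) < 0 := hl1 _ (hC.A_mem _) (by simp [hAB, hAp])
  have a20 : l2 (A (i + 1) - B (i + 1)) = 0 := hl2s _ (by simp)
  have a21 : l2 (chainVertex q i m - B (i + 1)) = 0 := hl2s _ (by simp)
  have a22 : l2 (B i - B (i + 1)) < 0 :=
    hl2 _ (hC.B_mem _) (by simp [(hAB i).symm, (hpB i).symm, hne10.symm])
  have a30 : l3 (B i - B (i + 1)) = 0 := hl3s _ (by simp)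
  have a31 : l3 (B (i + 2) - B (i + 1)) = 0 := hl3s _ (by simp)
  have a32 : l3 (chainVertex q i m - B (i + 1)) < 0 := hl3 _ hpm (by simp [hpB])
  have a33 : l3 (A (i + 1) - B (i + 1)) < 0 := hl3 _ (hC.A_mem _) (by simp [hAB])
  have hopp := hC.opposite i (Fin.ofNat (m + 2) m)
    (by simp [Fin.ext_iff, Fin.ofNat, Nat.mod_eq_of_lt (show m < m + 2 by omega), hm])
    (by simp [Fin.ext_iff, Fin.ofNat, Nat.mod_eq_of_lt (show m < m + 2 by omega)])
  obtain ⟨L, hLA, hL2, hL1, hLp⟩ := sOppSide_functional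
    (exists_det3_ne_zero (hC.B_mem i) (hC.A_mem (i + 1)) (hC.B_mem (i + 2)) (hAB i).symm
      hne20.symm (hAB _)) hopp
  change L (chainVertex q i m - B i) < 0 at hLp
  obtain ⟨w, hw⟩ := exists_det3_ne_zero (hC.B_mem (i + 1)) (hC.B_mem i) hpm hne10
    (hpB _).symm (hpB _).symm
  have hD := det3_ne_zero a10 a11 a12.ne hw
  set b1 := B (i + 1) with hb1
  set e1 := B i - b1 with he1
  set e2 := chainVertex q i m - b1 with he2
  set e3 := A (i + 1) - b1 with he3
  -- In coordinates at `B (i + 1)`, the two side facets give `a, c ≥ 0`, and the middle coordinate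
  -- tells the side of the visibility plane. The skylight gives `b' ≤ 0`, so leaving the cone means
  -- `b > 0`.
  obtain ⟨a, b, c, hxe, hb⟩ := exists_coords hD (x - b1)
  obtain ⟨a', b', c', hBe, -⟩ := exists_coords hD (B (i + 2) - b1)
  have ha0 : 0 ≤ a := by
    have := hl2P x hxP.1
    rw [hxe] at this
    simp only [map_add, map_smul, a20, a21, smul_eq_mul] at this
    nlinarith
  have hc0 : 0 ≤ c := by
    have := hl1P x hxP.1
    rw [hxe] at this
    simp only [map_add, map_smul, a10, a11, smul_eq_mul] at this
    nlinarith
  have hc0' : 0 ≤ c' := by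
    have := hl1P _ hBP
    rw [hBe] at this
    simp only [map_add, map_smul, a10, a11, smul_eq_mul] at this
    nlinarith
  have hb0' : b' ≤ 0 := by
    have := a31
    rw [hBe] at this
    simp only [map_add, map_smul, a30, smul_eq_mul] at this
    nlinarith
  have hbb : b' * b < 0 := by
    by_contra! hbb
    apply hx
    have : ({B i, b1, A (i + 1)} : Set Space3) = {b1, B i, A (i + 1)} := Set.insert_comm _ _ _
    rw [this]
    exact wSameSide_of_coords hBe hxe hbb
  have hb'neg : b' < 0 := lt_of_le_of_ne hb0' (by rintro rfl; simp at hbb)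
  have hbpos : 0 < b := by nlinarith
  have hLb1 : L (b1 - B i) = 1 := hL1
  have hLe1 : L e1 = -1 := by
    rw [he1, ← neg_sub, map_neg, hLb1]
  have hLe3 : L e3 = -1 := by
    rw [he3, show A (i + 1) - b1 = (A (i + 1) - B i) - (b1 - B i) by abel, map_sub, hLA, hLb1]
    ring
  have hLe2 : L e2 < -1 := by
    rw [he2, show chainVertex q i m - b1 = (chainVertex q i m - B i) - (b1 - B i) by abel, map_sub,
      hLb1]
    linarith
  have hLx : L (x - B i) = 1 - a - c + b * L e2 := by
    rw [show x - B i = (x - b1) + (b1 - B i) by abel, map_add, hLb1, hxe]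
    simp only [map_add, map_smul, smul_eq_mul, hLe1, hLe3]
    ring
  have hLB2 : 1 - a' - c' + b' * L e2 = 0 := by
    rw [← hL2, show B (i + 2) - B i = (B (i + 2) - b1) + (b1 - B i) by abel, map_add, hLb1, hBe]
    simp only [map_add, map_smul, smul_eq_mul, hLe1, hLe3]
    ring
  have hBmem : ∀ j, B j ∈ P := fun j => h.subset (hC.B_mem j).1
  have hAmem : A (i + 1) ∈ P := h.subset (hC.A_mem _).1
  -- Since `L e2 < -1`, the opposite inequality gives `a + b + c ≤ 1` and puts `x` in the
  -- tetrahedron of `B (i + 1)`, `B i`, `q i m`, `A (i + 1)`. As a vertex of `P`, `x` would be one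
  -- of these, and each is excluded.
  have hxneg : L (x - B i) < 0 := by
    by_contra! hge
    have hsum : a + b + c ≤ 1 := by nlinarith
    have hmem := mem_convexHull_four b1 (B i) (chainVertex q i m) (A (i + 1)) ha0 hbpos.le hc0 hsum
    have : b1 + a • (B i - b1) + b • (chainVertex q i m - b1) + c • (A (i + 1) - b1) = x := by
      rw [add_assoc, add_assoc, ← add_assoc (a • _), ← hxe]; abel
    rw [this] at hmem
    have hsub : convexHull ℝ {b1, B i, chainVertex q i m, A (i + 1)} ⊆ P := by
      refine convexHull_min ?_ h.polytope.convex
      rintro y (rfl | rfl | rfl | rfl)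
      · exact hBmem _
      · exact hBmem _
      · exact h.subset hpm.1
      · exact hAmem
    rcases mem_of_mem_extremePoints_of_mem_convexHull hxP hsub hmem with h' | h' | h' | h'
    · exact hxB ⟨_, h'.symm⟩
    · exact hxB ⟨_, h'.symm⟩
    · rw [h'] at hge; linarith
    · rw [h', det3_self_right, zero_div] at hb
      linarith
  have hxA : x ≠ A (i + 1) := by rintro rfl; linarith
  obtain ⟨r, r', s, s', hrr, hs, hs', hss, hpt⟩ :=
    exists_pierce hxe hBe hLb1 hLe1 hLe3 hL2 hxneg hbpos hb'neg
  refine hT.false_of_pierce ht ht' hxt (htB (i + 1)) (htB (i + 2)) hBt' hAt' ?_ ?_ ?_ ?_ ?_ ?_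
    hrr hs hs' hss hpt
  · exact fun he => hxB ⟨_, he.symm⟩
  · exact hxA
  · exact hne10
  · exact (hAB _).symm
  · exact hne20
  · exact (hAB _).symm

end IsCupolaIn

/-! ### From tetrahedra along the chain to interior edges -/

/-- The interior edges are the two-element interior faces. -/
theorem pair_mem_interiorFaces {P : Set Space3} {T : Finset (Finset Space3)} [DecidableEq Space3]
    {t : Finset Space3} (ht : t ∈ T) {u v : Space3} (hu : u ∈ t) (hv : v ∈ t) (huv : u ≠ v)
    (hint : ∃ x ∈ segment ℝ u v, x ∈ interior P) :
    ({u, v} : Finset Space3) ∈ (interiorFaces P T).filter fun F => F.card = 2 := by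
  classical
  refine Finset.mem_filter.2 ⟨Finset.mem_filter.2 ⟨mem_triangulationFaces.2 ⟨⟨u, by simp⟩, t, ht,
    ?_⟩, ?_⟩, Finset.card_pair huv⟩
  · simp [Finset.insert_subset_iff, hu, hv]
  · obtain ⟨x, hx, hxP⟩ := hint
    refine ⟨x, ?_, hxP⟩
    rwa [Finset.coe_pair, convexHull_pair]

/-- Two tetrahedra of a triangulation on the same side of a common triangle coincide. -/
theorem IsTriangulation.eq_of_same_side {P : Set Space3} {T : Finset (Finset Space3)}
    (hT : IsTriangulation P T) {t t' : Finset Space3} (ht : t ∈ T) (ht' : t' ∈ T)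
    {o a b u v : Space3} (ho : o ∈ t) (ha : a ∈ t) (hb : b ∈ t) (hu : u ∈ t)
    (ho' : o ∈ t') (ha' : a ∈ t') (hb' : b ∈ t') (hv : v ∈ t') {σ : ℝ}
    (h1 : 0 < σ * det3 (a - o) (u - o) (b - o)) (h2 : 0 < σ * det3 (a - o) (v - o) (b - o)) :
    u = v := by
  classical
  by_contra huv
  have hD : det3 (a - o) (u - o) (b - o) ≠ 0 := by
    intro h0; rw [h0, mul_zero] at h1; exact lt_irrefl _ h1
  obtain ⟨α, β, δ, hvc, hβ⟩ := exists_coords hD (v - o)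
  have hβpos : 0 < β := by
    rw [hβ, ← mul_div_mul_left _ _ (show σ ≠ 0 by rintro rfl; simp at h1)]
    exact div_pos h2 h1
  -- Shifting by `K` along the common triangle makes all coefficients nonnegative, and dividing by
  -- `N` brings the point into both tetrahedra. It is off the plane of the triangle, whereas the
  -- common face would lie in that plane.
  set K := 1 + |α| + |δ| with hK
  have hα : 0 ≤ α + K := by linarith [neg_abs_le α, abs_nonneg δ]
  have hδ : 0 ≤ δ + K := by linarith [neg_abs_le δ, abs_nonneg α]
  have hK0 : 0 < K := by positivity
  set N := 1 + 2 * K + (α + K) + (δ + K) + β with hN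
  have hN0 : 0 < N := by positivity
  have hp1 := mem_convexHull_four o a u b (r := (α + K) / N) (s := β / N) (t := (δ + K) / N)
    (by positivity) (by positivity) (by positivity)
    (by rw [← add_div, ← add_div, div_le_one hN0]; linarith)
  have hp2 := mem_convexHull_four o a v b (r := K / N) (s := 1 / N) (t := K / N)
    (by positivity) (by positivity) (by positivity)
    (by rw [← add_div, ← add_div, div_le_one hN0]; linarith)
  have heq : o + (K / N) • (a - o) + (1 / N) • (v - o) + (K / N) • (b - o) =
      o + ((α + K) / N) • (a - o) + (β / N) • (u - o) + ((δ + K) / N) • (b - o) := by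
    rw [hvc]; module
  rw [← heq] at hp1
  have hF : ({o, a, u, b} : Finset Space3) ∈ triangulationFaces T := by
    refine mem_triangulationFaces.2 ⟨⟨o, by simp⟩, t, ht, ?_⟩
    simp [Finset.insert_subset_iff, ho, ha, hb, hu]
  have hG : ({o, a, v, b} : Finset Space3) ∈ triangulationFaces T := by
    refine mem_triangulationFaces.2 ⟨⟨o, by simp⟩, t', ht', ?_⟩
    simp [Finset.insert_subset_iff, ho', ha', hb', hv]
  have hmem := hT.faces_inter hF hG ⟨by simpa using hp1, by simpa using hp2⟩
  let f : Space3 →L[ℝ] ℝ := det3L (b - o) (a - o)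
  have hfa : f (a - o) = 0 := det3_self_right _ _
  have hfb : f (b - o) = 0 := det3_self_left _ _
  have hfu : 0 < σ * f (u - o) := by
    change 0 < σ * det3 _ _ _
    rwa [det3_rotate]
  have hfv : 0 < σ * f (v - o) := by
    change 0 < σ * det3 _ _ _
    rwa [det3_rotate]
  have hub : u ≠ b := by rintro rfl; rw [hfb, mul_zero] at hfu; exact lt_irrefl _ hfu
  have hua : u ≠ a := by rintro rfl; rw [hfa, mul_zero] at hfu; exact lt_irrefl _ hfu
  have huo : u ≠ o := by rintro rfl; simp at hfu
  have hsub : convexHull ℝ ((({o, a, u, b} : Finset Space3) ∩ {o, a, v, b} : Finset Space3) :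
      Set Space3) ⊆ {y | f y = f o} := by
    refine convexHull_min ?_ (convex_hyperplane f.toLinearMap.isLinear _)
    intro y hy
    rw [Finset.mem_coe, Finset.mem_inter] at hy
    simp only [Finset.mem_insert, Finset.mem_singleton] at hy
    change f y = f o
    rw [← sub_eq_zero, ← map_sub]
    rcases hy.1 with rfl | rfl | rfl | rfl
    · simp
    · exact hfa
    · rcases hy.2 with h' | h' | h' | h'
      · exact absurd h' huo
      · exact absurd h' hua
      · exact absurd h' huv
      · exact absurd h' hub
    · exact hfb
  have hfp : f _ = f o := hsub hmem
  simp only [map_add, map_smul, hfa, hfb, smul_eq_mul, mul_zero, add_zero] at hfp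
  have : N⁻¹ * f (v - o) = 0 := by linarith
  rcases mul_eq_zero.1 this with h' | h'
  · exact (inv_ne_zero hN0.ne') h'
  · rw [h', mul_zero] at hfv
    exact lt_irrefl _ hfv

/-- A tetrahedron containing a point pushed off an edge `o, u` in the plane `f = 0` has vertices on
both sides of this plane. -/
theorem false_of_one_sided {t : Finset Space3} {o u z : Space3} {f g : Space3 →L[ℝ] ℝ}
    (hfz : f (z - o) = 0) (hfu : f (u - o) = 0) (hgu : g (u - o) = 0) (hgz : g (z - o) ≠ 0)
    {s : ℝ} (hs : 0 < s)
    (hp : AffineMap.lineMap (midpoint ℝ o u) z s ∈ convexHull ℝ (t : Set Space3))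
    (ht : ∀ y ∈ t, y = o ∨ y = u ∨ 0 < f (y - o)) : False := by
  rw [Finset.convexHull_eq] at hp
  obtain ⟨w, hw0, hw1, hwx⟩ := hp
  rw [Finset.centerMass_eq_of_sum_1 _ _ hw1] at hwx
  have hpo : (AffineMap.lineMap (midpoint ℝ o u) z s : Space3) - o =
      ((1 - s) / 2) • (u - o) + s • (z - o) := by
    rw [AffineMap.lineMap_apply_module, midpoint_eq_smul_add, invOf_eq_inv]
    module
  have hsum : ∑ y ∈ t, w y • (y - o) = ((1 - s) / 2) • (u - o) + s • (z - o) := by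
    rw [← hpo, ← hwx]
    simp only [smul_sub, Finset.sum_sub_distrib, ← Finset.sum_smul, hw1, one_smul, id]
  -- The point is in the plane `f = 0`, so vertices with `f > 0` have weight zero; the point is then
  -- on the line of the edge, which `g` refutes.
  have hf0 : ∑ y ∈ t, w y * f (y - o) = 0 := by
    have := congrArg f hsum
    simpa [map_sum, hfz, hfu] using this
  have hnn : ∀ y ∈ t, 0 ≤ w y * f (y - o) := by
    intro y hy
    refine mul_nonneg (hw0 y hy) ?_
    rcases ht y hy with rfl | rfl | h
    · simp
    · exact hfu.ge
    · exact h.le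
  have hz := (Finset.sum_eq_zero_iff_of_nonneg hnn).1 hf0
  have hg0 : ∑ y ∈ t, w y * g (y - o) = s * g (z - o) := by
    have := congrArg g hsum
    simpa [map_sum, hgu] using this
  have : ∑ y ∈ t, w y * g (y - o) = 0 := by
    refine Finset.sum_eq_zero fun y hy => ?_
    rcases ht y hy with rfl | rfl | h
    · simp
    · rw [hgu, mul_zero]
    · rcases mul_eq_zero.1 (hz y hy) with h' | h'
      · rw [h', zero_mul]
      · exact absurd h' h.ne'
  rw [this] at hg0
  exact (mul_ne_zero hs.ne' hgz) hg0.symm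

namespace IsCupolaIn

variable {m : ℕ} {A B : Fin 3 → Space3} {q : Fin 3 → Fin (m + 2) → Space3} {C P : Set Space3}
  {φ : Space3 →L[ℝ] ℝ} {γ : ℝ} {T : Finset (Finset Space3)}

/-- Seen from `B i`, the `i`-th chain is in convex position. -/
theorem exists_orientation (h : IsCupolaIn m A B q C P φ γ) (hm : m ≠ 0) (i : Fin 3) :
    ∃ σ : ℝ, ∀ a b c, a < b → b < c → c ≤ m + 1 → 0 < σ * det3 (chainVertex q i a - B i)
      (chainVertex q i b - B i) (chainVertex q i c - B i) := by
  have hC := h.cupola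
  have hne : ∀ j ≤ m + 1, chainVertex q i j ≠ B i := fun j hj he =>
    Fin.add_two_ne_self i ((hC.chainVertex_eq_B hj).1 he).1.symm
  refine det3_chain (v := fun j => chainVertex q i j - B i) (N := m + 1) (by omega) ?_ ?_
  · intro k hk
    obtain ⟨l, -, hl0, hl⟩ := h.exists_functional_at (.left i k (by omega)) (f := B i) (by simp)
      (h.B_lt i)
    refine ⟨l, hl0 _ (by simp), hl0 _ (by simp), fun j hj h1 h2 => hl _ (hC.chainVertex_mem i j) ?_⟩
    rintro (he | he | he)
    · exact hne j hj he
    · exact h1 ((hC.chainVertex_inj hj (by omega)).1 he).2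
    · exact h2 ((hC.chainVertex_inj hj (by omega)).1 he).2
  · refine exists_det3_ne_zero (hC.B_mem i) (hC.chainVertex_mem i 0) (hC.chainVertex_mem i 1)
      (hne 0 (by omega)).symm (hne 1 (by omega)).symm ?_
    rw [Ne, hC.chainVertex_inj (by omega) (by omega)]
    omega

/-- For every inner chain vertex there is a tetrahedron at the edge to `B i` which either has
chain vertices on both sides, or a vertex off the chain. -/
theorem exists_tetrahedron (h : IsCupolaIn m A B q C P φ γ) (hT : IsTriangulation P T)
    (i : Fin 3) {k : ℕ} (hk : k ≠ 0) (hkm : k ≤ m) :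
    ∃ t ∈ T, B i ∈ t ∧ chainVertex q i k ∈ t ∧
      ((∃ a b, a < k ∧ k < b ∧ b ≤ m + 1 ∧ chainVertex q i a ∈ t ∧ chainVertex q i b ∈ t) ∨
        ∃ y ∈ t, y ≠ B i ∧ ∀ j ≤ m + 1, y ≠ chainVertex q i j) := by
  have hC := h.cupola
  obtain ⟨σ, hσ⟩ := h.exists_orientation (by omega) i
  have hCP : ∀ j, chainVertex q i j ∈ P := fun j => h.subset (hC.chainVertex_mem i j).1
  set z := midpoint ℝ (chainVertex q i 0) (chainVertex q i (m + 1)) with hz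
  have hzP : z ∈ P := h.polytope.convex.midpoint_mem (hCP _) (hCP _)
  set mid := midpoint ℝ (B i) (chainVertex q i k) with hmid
  have hmidP : mid ∈ P := h.polytope.convex.midpoint_mem (h.subset (hC.B_mem i).1) (hCP _)
  -- The tetrahedra missing the midpoint of the edge form a closed set, so points close to the
  -- midpoint lie in tetrahedra that contain it.
  have hclosed : IsClosed (⋃ t ∈ {t : Finset Space3 | t ∈ T ∧ mid ∉ convexHull ℝ (t : Set Space3)},
      convexHull ℝ (t : Set Space3)) :=
    (T.finite_toSet.subset (fun t ht => ht.1)).isClosed_biUnion fun t _ =>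
      (t.finite_toSet.isCompact_convexHull ℝ).isClosed
  have hcont : Tendsto (fun s : ℝ => (AffineMap.lineMap mid z s : Space3)) (𝓝[>] 0) (𝓝 mid) := by
    have : Continuous fun s : ℝ => (AffineMap.lineMap mid z s : Space3) := by fun_prop
    have h0 := this.tendsto 0
    rw [AffineMap.lineMap_apply_zero] at h0
    exact h0.mono_left nhdsWithin_le_nhds
  have hev := hcont.eventually (hclosed.isOpen_compl.mem_nhds (x := mid) (by
    simp only [Set.mem_compl_iff, Set.mem_iUnion, not_exists]
    rintro t ⟨-, ht⟩
    exact ht))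
  obtain ⟨s, hs, hs0, hs1⟩ := (hev.and (Ioo_mem_nhdsGT (zero_lt_one' ℝ))).exists
  have hpP := h.polytope.convex.lineMap_mem hmidP hzP ⟨hs0.le, hs1.le⟩
  rw [← hT.cover] at hpP
  simp only [Set.mem_iUnion] at hpP
  obtain ⟨t, ht, hpt⟩ := hpP
  have hmt : mid ∈ convexHull ℝ (t : Set Space3) := by
    by_contra hmt
    refine hs ?_
    simp only [Set.mem_iUnion]
    exact ⟨t, ⟨ht, hmt⟩, hpt⟩
  obtain ⟨hBt, hct⟩ := h.edge_B_chain i hk hkm (hT.vertices t ht) hmt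
  refine ⟨t, ht, hBt, hct, ?_⟩
  by_contra! hcon
  obtain ⟨hcon1, hcon2⟩ := hcon
  have hform : ∀ y ∈ t, y = B i ∨ ∃ j ≤ m + 1, y = chainVertex q i j := by
    intro y hy
    by_cases hyB : y = B i
    · exact Or.inl hyB
    · exact Or.inr (hcon2 y hy hyB)
  have hzo : z - B i = (2 : ℝ)⁻¹ • (chainVertex q i 0 - B i) +
      (2 : ℝ)⁻¹ • (chainVertex q i (m + 1) - B i) := by
    rw [hz, midpoint_eq_smul_add, invOf_eq_inv]; module
  -- `f` vanishes on the plane through the edge and `z`. By convex position this plane separates the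
  -- chain vertices before `k` from those after `k`.
  let f : Space3 →L[ℝ] ℝ := det3L (z - B i) (chainVertex q i k - B i)
  let g : Space3 →L[ℝ] ℝ := det3L (chainVertex q i 0 - B i) (chainVertex q i k - B i)
  have hfz : f (z - B i) = 0 := det3_self_left _ _
  have hfk : f (chainVertex q i k - B i) = 0 := det3_self_right _ _
  have hgk : g (chainVertex q i k - B i) = 0 := det3_self_right _ _
  have hg : 0 < σ * g (z - B i) := by
    have := hσ 0 k (m + 1) (by omega) (by omega) le_rfl
    rw [hzo]
    change 0 < σ * det3 _ _ _
    rw [det3_add, det3_smul, det3_smul, det3_self_left]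
    linarith
  have hgz : g (z - B i) ≠ 0 := fun h0 => by rw [h0, mul_zero] at hg; exact lt_irrefl _ hg
  have hfexp : ∀ y, f y = 2⁻¹ * det3 (chainVertex q i k - B i) y (chainVertex q i 0 - B i) +
      2⁻¹ * det3 (chainVertex q i k - B i) y (chainVertex q i (m + 1) - B i) := by
    intro y
    change det3 _ _ _ = _
    rw [det3_rotate, hzo, det3_add, det3_smul, det3_smul]
  have hfpos : ∀ j, k < j → j ≤ m + 1 → 0 < σ * f (chainVertex q i j - B i) := by
    intro j hkj hj
    rw [hfexp]
    have p1 := hσ 0 k j (by omega) hkj hj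
    rw [det3_rotate] at p1
    rcases hj.lt_or_eq with hj' | rfl
    · have p2 := hσ k j (m + 1) hkj hj' le_rfl
      linarith
    · rw [det3_self_right]; linarith
  have hfneg : ∀ j, j < k → 0 < (-σ) * f (chainVertex q i j - B i) := by
    intro j hkj
    rw [hfexp]
    have p2 := hσ j k (m + 1) hkj (by omega) le_rfl
    rw [det3_swap] at p2
    rcases Nat.eq_zero_or_pos j with rfl | hj
    · rw [det3_self_right]; linarith
    · have p1 := hσ 0 j k hj hkj (by omega)
      rw [det3_swap', det3_rotate] at p1
      linarith
  by_cases hb : ∃ b, k < b ∧ b ≤ m + 1 ∧ chainVertex q i b ∈ t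
  · obtain ⟨b, hkb, hb, hbt⟩ := hb
    refine false_of_one_sided (f := σ • f) (g := g) (by simp [hfz]) (by simp [hfk]) hgk hgz hs0 hpt
      fun y hy => ?_
    rcases hform y hy with rfl | ⟨j, hj, rfl⟩
    · exact Or.inl rfl
    · rcases lt_trichotomy j k with hjk | rfl | hjk
      · exact absurd hbt (hcon1 j b hjk hkb hb hy)
      · exact Or.inr (Or.inl rfl)
      · exact Or.inr (Or.inr (hfpos j hjk hj))
  · push Not at hb
    refine false_of_one_sided (f := (-σ) • f) (g := g) (by simp [hfz]) (by simp [hfk]) hgk hgz hs0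
      hpt fun y hy => ?_
    rcases hform y hy with rfl | ⟨j, hj, rfl⟩
    · exact Or.inl rfl
    · rcases lt_trichotomy j k with hjk | rfl | hjk
      · exact Or.inr (Or.inr (hfneg j hjk))
      · exact Or.inr (Or.inl rfl)
      · exact absurd hy (hb j hjk hj)

open Classical in
/-- If the diagonal from `B i` to `A (i + 1)` is not an edge of the triangulation, then there are
at least `m` interior edges. -/
theorem le_card_interior_edges (h : IsCupolaIn m A B q C P φ γ) (hm : m ≠ 0)
    (hT : IsTriangulation P T) {i : Fin 3} (hdiag : ∀ t ∈ T, B i ∈ t → A (i + 1) ∉ t) :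
    m ≤ ((interiorFaces P T).filter fun F => F.card = 2).card := by
  have hC := h.cupola
  obtain ⟨σ, hσ⟩ := h.exists_orientation hm i
  set V : ℕ → Space3 := fun j => chainVertex q i j with hV
  have hinj : ∀ j l, j ≤ m + 1 → l ≤ m + 1 → V j = V l → j = l := fun j l hj hl he =>
    ((hC.chainVertex_inj hj hl).1 he).2
  have hVB : ∀ j ≤ m + 1, V j ≠ B i := fun j hj he =>
    Fin.add_two_ne_self i ((hC.chainVertex_eq_B hj).1 he).1.symm
  -- `R k e` records how the edge `e` arises from the index `k`. The three forms contain two, one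
  -- and no vertices of the chain, so they cannot coincide.
  let R : ℕ → Finset Space3 → Prop := fun k e =>
    (∃ a b, a < k ∧ k < b ∧ b ≤ m + 1 ∧ e = {V a, V b} ∧
      ∃ t ∈ T, B i ∈ t ∧ V k ∈ t ∧ V a ∈ t ∧ V b ∈ t) ∨
    (∃ y, y ≠ B i ∧ (∀ j ≤ m + 1, y ≠ V j) ∧ e = {V k, y}) ∨
    (k = 1 ∧ ∃ y, y ≠ B i ∧ (∀ j ≤ m + 1, y ≠ V j) ∧ e = {B i, y})
  have hex : ∀ k, k ≠ 0 → k ≤ m →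
      ∃ e ∈ (interiorFaces P T).filter fun F => F.card = 2, R k e := by
    intro k hk hkm
    obtain ⟨t, ht, hBt, hct, ⟨a, b, hak, hkb, hb, hat, hbt⟩ | ⟨y, hyt, hyB, hyc⟩⟩ :=
      h.exists_tetrahedron hT i hk hkm
    · refine ⟨{V a, V b}, ?_, Or.inl ⟨a, b, hak, hkb, hb, rfl, t, ht, hBt, hct, hat, hbt⟩⟩
      refine pair_mem_interiorFaces ht hat hbt
        (fun he => by have := hinj a b (by omega) hb he; omega) ?_
      rw [segment_symm]
      exact h.interior_chain_chain i (by omega) hb (hT.vertices t ht hat)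
    · have hyP := hT.vertices t ht hyt
      have hyA : y ≠ A (i + 1) := by rintro rfl; exact hdiag t ht hBt hyt
      rcases h.interior_chain_of_ne i hk hkm hyP hyB hyA hyc with hint | ⟨hyC, hk1⟩
      · exact ⟨{V k, y}, pair_mem_interiorFaces ht hct hyt (hyc k (by omega)).symm hint,
          Or.inr (Or.inl ⟨y, hyB, hyc, rfl⟩)⟩
      · exact ⟨{B i, y}, pair_mem_interiorFaces ht hBt hyt hyB.symm
          (h.interior_B_of_notMem hm i hyP hyC), Or.inr (Or.inr ⟨hk1, y, hyB, hyc, rfl⟩)⟩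
  have huniq : ∀ k k' e, k ≤ m → k' ≤ m → R k e → R k' e → k = k' := by
    intro k k' e hk hk' h1 h2
    rcases h1 with ⟨a, b, hak, hkb, hb, rfl, t, ht, hBt, hkt, hat, hbt⟩ |
      ⟨y, hyB, hyc, rfl⟩ | ⟨rfl, y, hyB, hyc, rfl⟩
    · rcases h2 with ⟨a', b', hak', hkb', hb', he, t', ht', hBt', hkt', hat', hbt'⟩ |
        ⟨y', hyB', hyc', he⟩ | ⟨-, y', hyB', hyc', he⟩
      · have e1 : V a ∈ ({V a', V b'} : Finset Space3) := he ▸ by simp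
        have e2 : V b ∈ ({V a', V b'} : Finset Space3) := he ▸ by simp
        simp only [Finset.mem_insert, Finset.mem_singleton] at e1 e2
        have i1 : a = a' ∨ a = b' :=
          e1.imp (hinj a a' (by omega) (by omega)) (hinj a b' (by omega) (by omega))
        have i2 : b = a' ∨ b = b' :=
          e2.imp (hinj b a' (by omega) (by omega)) (hinj b b' (by omega) (by omega))
        obtain rfl : a = a' := by omega
        obtain rfl : b = b' := by omega
        -- Both tetrahedra contain the triangle of `B i`, `V a`, `V b`, and both `V k` and `V k'`
        -- lie on the side prescribed by the orientation of the chain.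
        exact hinj k k' (by omega) (by omega) (hT.eq_of_same_side ht ht' hBt hat hbt hkt hBt' hat'
          hbt' hkt' (hσ a k b hak hkb hb) (hσ a k' b hak' hkb' hb))
      · have e1 : y' ∈ ({V a, V b} : Finset Space3) := he ▸ by simp
        simp only [Finset.mem_insert, Finset.mem_singleton] at e1
        rcases e1 with e1 | e1
        · exact absurd e1 (hyc' a (by omega))
        · exact absurd e1 (hyc' b hb)
      · have e1 : y' ∈ ({V a, V b} : Finset Space3) := he ▸ by simp
        simp only [Finset.mem_insert, Finset.mem_singleton] at e1
        rcases e1 with e1 | e1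
        · exact absurd e1 (hyc' a (by omega))
        · exact absurd e1 (hyc' b hb)
    · rcases h2 with ⟨a', b', hak', hkb', hb', he, -⟩ |
        ⟨y', hyB', hyc', he⟩ | ⟨-, y', hyB', hyc', he⟩
      · have e1 : y ∈ ({V a', V b'} : Finset Space3) := he ▸ by simp
        simp only [Finset.mem_insert, Finset.mem_singleton] at e1
        rcases e1 with e1 | e1
        · exact absurd e1 (hyc a' (by omega))
        · exact absurd e1 (hyc b' hb')
      · have e1 : V k ∈ ({V k', y'} : Finset Space3) := he ▸ by simp
        simp only [Finset.mem_insert, Finset.mem_singleton] at e1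
        rcases e1 with e1 | e1
        · exact hinj k k' (by omega) (by omega) e1
        · exact absurd e1.symm (hyc' k (by omega))
      · have e1 : V k ∈ ({B i, y'} : Finset Space3) := he ▸ by simp
        simp only [Finset.mem_insert, Finset.mem_singleton] at e1
        rcases e1 with e1 | e1
        · exact absurd e1 (hVB k (by omega))
        · exact absurd e1.symm (hyc' k (by omega))
    · rcases h2 with ⟨a', b', hak', hkb', hb', he, -⟩ |
        ⟨y', hyB', hyc', he⟩ | ⟨h1, -⟩
      · have e1 : y ∈ ({V a', V b'} : Finset Space3) := he ▸ by simp
        simp only [Finset.mem_insert, Finset.mem_singleton] at e1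
        rcases e1 with e1 | e1
        · exact absurd e1 (hyc a' (by omega))
        · exact absurd e1 (hyc b' hb')
      · have e1 : V k' ∈ ({B i, y} : Finset Space3) := he ▸ by simp
        simp only [Finset.mem_insert, Finset.mem_singleton] at e1
        rcases e1 with e1 | e1
        · exact absurd e1 (hVB k' (by omega))
        · exact absurd e1.symm (hyc k' (by omega))
      · exact h1.symm
  have hex' : ∀ k : Fin m, ∃ e ∈ (interiorFaces P T).filter fun F => F.card = 2,
      R (k + 1) e := fun k => hex _ (by omega) (by omega)
  choose e he hR using hex'
  have := Finset.card_le_card_of_injOn (s := (Finset.univ : Finset (Fin m)))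
    (t := (interiorFaces P T).filter fun F => F.card = 2) e (fun k _ => he k)
    (fun k _ k' _ hkk => by
      have := huniq (k + 1) (k' + 1) (e k) (by omega) (by omega) (hR k)
        (by rw [hkk]; exact hR k')
      exact Fin.ext (by omega))
  simpa using this

end IsCupolaIn

theorem mainTheorem6 (m : ℕ) (A B : Fin 3 → Space3) (q : Fin 3 → Fin (m + 2) → Space3)
    (C P Q : Set Space3)
    (hC : IsCupola m A B q C)
    (hP : IsConvexPolytope P) (hCP : C ⊆ P)
    (hQ : IsConvexPolytope Q) (hQPC : Q = closure (P \ C))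
    (hQfacet : IsFacet Q (convexHull ℝ (Set.range A)))
    (n : ℕ) (hn : n = (Set.extremePoints ℝ P).ncard)
    (T : Finset (Finset Space3)) (hT : IsTriangulation P T)
    (t : Finset Space3) (ht : t ∈ T) (htB : ∀ i, B i ∈ t)
    (x : Space3) (hxt : x ∈ t) (hxB : x ∉ Set.range B)
    (hx : x ∉ visibilityCone A B) :
    (n : ℤ) + (m : ℤ) - 3 ≤ (T.card : ℤ) := by
  classical
  have hcard := hT.card_add_three hP
  rw [← hn] at hcard
  -- For `m = 0` the counting formula suffices, as the number of interior edges is nonnegative.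
  rcases Nat.eq_zero_or_pos m with rfl | hm
  · push_cast
    omega
  · obtain ⟨φ, γ, h⟩ := hC.exists_isCupolaIn hP hCP hQ hQPC hQfacet
    have hx' : ∃ i, ¬ (affineSpan ℝ {B i, B (i + 1), A (i + 1)}).WSameSide (B (i + 2)) x := by
      by_contra! hall
      exact hx hall
    obtain ⟨i, hi⟩ := hx'
    have hle := h.le_card_interior_edges hm.ne' hT
      (h.not_diagonal hm.ne' hT ht htB hxt hxB hi)
    have : ((m : ℕ) : ℤ) ≤ ((interiorFaces P T).filter fun F => F.card = 2).card := by
      exact_mod_cast hle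
    linarith
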